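/- Let $X$ be a complex Banach space, and let $T,F$ be commuting bounded linear operators on $X$ such that $F^n$ has finite rank for some integer $n\ge 1$. Conventions. A bounded operator $S$ is *meromorphic* if $0$ is the only possible accumulation point of its spectrum $\sigma(S)$ and every non-zero isolated point of $\sigma(S)$ is a pole of the resolvent of $S$; it is a *translate of a meromorphic operator* if $S-\lambda I$ is meromorphic for some $\lambda\in\mathbb C$. $S$ is *B-Fredholm* if, for some integer $k\ge 0$, the range $R(S^k)$ is closed and the restriction of $S$ to an operator $R(S^k)\to R(S^k)$ is Fredholm; $\sigma_{BF}(S)$ is the set of $\lambda\in\mathbb C$ such that $S-\lambda I$ is not B-Fredholm. For $f$ analytic on an open set $U\supseteq\sigma(S)$, $f(S)=\frac1{2\pi i}\int_\Gamma f(z)(z-S)^{-1}\,dz$, where $\Gamma$ is a finite system of closed piecewise $C^1$ curves in $U\setminus\sigma(S)$ of total winding number $1$ about every point of $\sigma(S)$ and $0$ about every point outside $U$. Then the following are equivalent: 1. There is a non-constant complex polynomial $P$ such that $P(T+F)$ is meromorphic. 2. There are an open set $U\subseteq\mathbb C$ containing $\sigma(T)\cup\sigma(T+F)$ and an analytic function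 $f:U\to\mathbb C$, not constant on any connected component of $U$ that meets $\sigma(T)$, such that $f(T+F)$ is meromorphic. 3. $\sigma_{BF}(T)$ is a finite set, possibly empty. 4. There are finitely many closed $T$-invariant subspaces $X_1,\dots,X_n$ of $X$ such that $X=X_1\oplus\dots\oplus X_n$ and each restriction $T|_{X_i}:X_i\to X_i$ is a translate of a meromorphic operator. -/

import Mathlib

open Filter Topology

namespace MeromorphicOperator

noncomputable section

section Operators

variable {X : Type*} [NormedAddCommGroup X] [NormedSpace ℂ X]

/-- `l` is a pole of `g`: `g` is meromorphic at `l`, of negative order. -/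
def IsPole {E : Type*} [NormedAddCommGroup E] [NormedSpace ℂ E] (g : ℂ → E) (l : ℂ) : Prop :=
  MeromorphicAt g l ∧ meromorphicOrderAt g l < 0

/-- A bounded operator is meromorphic if `0` is the only possible accumulation point of its
spectrum and every non-zero isolated point of the spectrum is a pole of the resolvent.
(`resolvent T z` is `(z - T)⁻¹`, whose poles are those of `(T - z)⁻¹`.) -/
def IsMeromorphic (T : X →L[ℂ] X) : Prop :=
  (∀ l : ℂ, AccPt l (𝓟 (spectrum ℂ T)) → l = 0) ∧
  ∀ l ∈ spectrum ℂ T, l ≠ 0 → ¬ AccPt l (𝓟 (spectrum ℂ T)) → IsPole (resolvent T) l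

/-- A translate of a meromorphic operator: `T - l` is meromorphic for some scalar `l`. -/
def IsTranslateOfMeromorphic (T : X →L[ℂ] X) : Prop :=
  ∃ l : ℂ, IsMeromorphic (T - l • ContinuousLinearMap.id ℂ X)

/-- The range of `T ^ n` is invariant under `T`. -/
theorem map_mem_range_pow (T : X →L[ℂ] X) (n : ℕ) :
    ∀ x ∈ (T ^ n).range, T x ∈ (T ^ n).range := by
  rintro x ⟨y, rfl⟩
  refine ⟨T y, ?_⟩
  change (T ^ n * T) y = (T * T ^ n) y
  rw [← pow_succ, ← pow_succ']

/-- `T` is B-Fredholm if, for some `n ≥ 0`, the range of `T ^ n` is closed and the restriction of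
`T` to it, as an operator from the range of `T ^ n` to itself, is a Fredholm operator. -/
def IsBFredholm (T : X →L[ℂ] X) : Prop :=
  ∃ n : ℕ, IsClosed ((T ^ n).range : Set X) ∧
    (T.restrict (map_mem_range_pow T n)).IsFredholm

/-- The B-Fredholm spectrum. -/
def bFredholmSpectrum (T : X →L[ℂ] X) : Set ℂ :=
  {l : ℂ | ¬ IsBFredholm (T - l • ContinuousLinearMap.id ℂ X)}

end Operators

section FunctionalCalculus

/-- `∫_γ g(z) dz` along `γ : [0,1] → ℂ`. -/
def contourIntegral {E : Type*} [NormedAddCommGroup E] [NormedSpace ℂ E]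
    (γ : ℝ → ℂ) (g : ℂ → E) : E :=
  ∫ t in (0 : ℝ)..1, deriv γ t • g (γ t)

/-- The winding number `(2πi)⁻¹ ∫_γ dz / (z - w)`. -/
def windingNumber (γ : ℝ → ℂ) (w : ℂ) : ℂ :=
  (2 * Real.pi * Complex.I)⁻¹ * contourIntegral γ (fun z => (z - w)⁻¹)

/-- The finite system `Γ` of closed curves surrounds `K` in `U`: it lies in `U \ K`, winds once
around every point of `K`, and does not wind around any point outside `U`.
The curves are `C¹` in the parameter, with no condition on the derivative other than continuity;
since a parametrization may come to rest at a corner, this covers piecewise `C¹` curves. -/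
structure Surrounds {m : ℕ} (Γ : Fin m → ℝ → ℂ) (K U : Set ℂ) : Prop where
  contDiff : ∀ j, ContDiff ℝ 1 (Γ j)
  closed : ∀ j, Γ j 0 = Γ j 1
  mem : ∀ j, ∀ t ∈ Set.Icc (0 : ℝ) 1, Γ j t ∈ U \ K
  winding_eq_one : ∀ w ∈ K, ∑ j, windingNumber (Γ j) w = 1
  winding_eq_zero : ∀ w ∉ U, ∑ j, windingNumber (Γ j) w = 0

variable {X : Type*} [NormedAddCommGroup X] [NormedSpace ℂ X]

/-- `A = f(S)` in the holomorphic (Riesz-Dunford) functional calculus, for `f` analytic on the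
open neighbourhood `U` of the spectrum of `S`:
`A = (2πi)⁻¹ ∫_Γ f(z) (z - S)⁻¹ dz` with `Γ` surrounding the spectrum of `S` in `U`. -/
def IsFunctionOf (S : X →L[ℂ] X) (U : Set ℂ) (f : ℂ → ℂ) (A : X →L[ℂ] X) : Prop :=
  ∃ (m : ℕ) (Γ : Fin m → ℝ → ℂ), Surrounds Γ (spectrum ℂ S) U ∧
    A = (2 * Real.pi * Complex.I : ℂ)⁻¹ •
      ∑ j, contourIntegral (Γ j) (fun z => f z • resolvent S z)

end FunctionalCalculus

end

end MeromorphicOperator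

open MeromorphicOperator

/-! Everything is expressed through Drazin invertibility: `IsDrazin a` means that some idempotent
commuting with `a` splits it into an invertible corner and a nilpotent one. In a complex Banach
algebra, `a - l` is Drazin invertible exactly when `l` lies in the resolvent set or is a pole of the
resolvent. Hence an operator is meromorphic iff its Drazin spectrum is contained in {0}
(`isMeromorphic_iff`), and each of the four conditions amounts to finiteness of `drazinSpectrum T`.

Perturbation: the idempotent of F splits F into a finite-rank part and a nilpotent part, and neither
destroys Drazin invertibility. So T and T + F have the same Drazin spectrum, although their spectra
may differ.

Functional calculus: f(T+F) - f(μ) = (T+F-μ)^n g(T+F) with g(μ) ≠ 0, and Drazin invertibility passes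
to the factor T+F-μ (`Surrounds.isDrazin_sub`). The Drazin spectrum of T therefore consists of zeros
of f in σ(T), and there are finitely many by compactness and the identity theorem. Conversely, if D
is the finite Drazin spectrum of S and P = X ∏ (X - z) over D, then for λ ≠ 0 no root of P - λ lies
in D, so P(S) - λ is a product of commuting Drazin invertible factors.

B-Fredholm spectrum: Drazin invertible operators are B-Fredholm. Conversely, a B-Fredholm operator
that is a limit of invertible translates is Drazin invertible. The complement of a finite set is
connected, so this property spreads from near infinity to the whole complement
(`drazinSpectrum_subset_of_finite`).

Decomposition: Riesz idempotents of small circles around the Drazin points cut X into pieces, each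
with at most one Drazin point. Conversely, all Drazin points lie among the centres of the
translates.

The calculus for a general cycle rests on the homological form of Cauchy's theorem, proved by
Dixon's argument with Liouville's theorem. -/

namespace MeromorphicOperator

noncomputable section

/-! ### Drazin invertibility in a ring. -/

section DrazinRing

variable {A : Type*} [Ring A]

/-- `a` is Drazin invertible: `a ^ p = a ^ (p + 1) * x` for some `p` and some `x` commuting
with `a`. -/
def IsDrazin (a : A) : Prop := ∃ (p : ℕ) (x : A), Commute a x ∧ a ^ p = a ^ (p + 1) * x

theorem pow_add_eq_of_pow_eq {a x : A} {p : ℕ} (h : a ^ p = a ^ (p + 1) * x) (k : ℕ) :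
    a ^ (k + p) = a ^ (k + p + 1) * x := by
  rw [pow_add a k p, h, add_assoc, pow_add a k (p + 1), mul_assoc]

theorem pow_eq_pow_add_mul_pow {a x : A} {p : ℕ} (h : a ^ p = a ^ (p + 1) * x) (k : ℕ) :
    a ^ p = a ^ (k + p) * x ^ k := by
  induction k with
  | zero => simp
  | succ k ih =>
    rw [pow_succ' x, ← mul_assoc, show k + 1 + p = k + p + 1 by ring,
      ← pow_add_eq_of_pow_eq h, ← ih]

/-- The spectral idempotent `e` and the Drazin inverse `d` of a Drazin invertible element. -/
theorem IsDrazin.exists_core {a : A} (h : IsDrazin a) :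
    ∃ (p : ℕ) (e d : A), e * e = e ∧ a * d = e ∧ d * a = e ∧ d * e = d ∧ a ^ p * e = a ^ p ∧
      ∀ s, Commute s a → Commute s e ∧ Commute s d := by
  obtain ⟨p, x, hc, h⟩ := h
  have hcp : ∀ i j, Commute (a ^ i) (x ^ j) := fun i j => hc.pow_pow i j
  have hp := pow_eq_pow_add_mul_pow h p
  have he : a ^ p * x ^ p * (a ^ p * x ^ p) = a ^ p * x ^ p := by
    rw [mul_assoc, ← mul_assoc (x ^ p), ← (hcp p p).eq, ← mul_assoc, ← mul_assoc, ← pow_add, ← hp]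
  have had : a * (a ^ p * x ^ (p + 1)) = a ^ p * x ^ p := by
    rw [← mul_assoc, ← pow_succ', pow_succ' x, ← mul_assoc, ← h]
  have hda : a ^ p * x ^ (p + 1) * a = a ^ p * x ^ p := by
    rw [← had]
    exact (((Commute.refl a).pow_right p).mul_right (hc.pow_right _)).eq.symm
  have hde : a ^ p * x ^ (p + 1) * (a ^ p * x ^ p) = a ^ p * x ^ (p + 1) := by
    rw [← had, ← mul_assoc, hda, pow_succ x, ← mul_assoc, ← mul_assoc, mul_assoc (_ * _) (a ^ p),
      he, mul_assoc]
  have hpe : a ^ p * (a ^ p * x ^ p) = a ^ p := by rw [← mul_assoc, ← pow_add, ← hp]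
  have hpe' : a ^ p * x ^ p * a ^ p = a ^ p := by
    rw [mul_assoc, ← (hcp p p).eq, hpe]
  generalize hE : a ^ p * x ^ p = e at *
  generalize hD : a ^ p * x ^ (p + 1) = d at *
  refine ⟨p, e, d, he, had, hda, hde, hpe, fun s hs => ?_⟩
  -- Here `s` need not commute with `x`. Since `e` has `a ^ p` as a factor on either side and `a ^
  -- p` is killed by `1 - e`, both off-diagonal corners of `s` vanish.
  have h1 : e * s * (1 - e) = 0 := by
    have : e = x ^ p * a ^ p := by rw [← hE, (hcp p p).eq]
    rw [this, mul_assoc (x ^ p), (hs.pow_right p).symm.eq, mul_assoc, mul_assoc, ← this,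
      mul_sub, mul_one, hpe]
    simp
  have h2 : (1 - e) * s * e = 0 := by
    have h3 : s * e = a ^ p * (s * x ^ p) := by
      rw [← hE, ← mul_assoc, (hs.pow_right p).eq, mul_assoc]
    rw [mul_assoc, h3, ← mul_assoc, sub_mul, one_mul, hpe']
    simp
  have hse : Commute s e := by
    have h1' : e * s = e * s * e := by
      rw [mul_sub, mul_one, sub_eq_zero] at h1; exact h1
    have h2' : s * e = e * s * e := by
      rw [sub_mul, sub_mul, one_mul, sub_eq_zero] at h2; exact h2
    exact h2'.trans h1'.symm
  refine ⟨hse, ?_⟩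
  have hed : e * d = d := by rw [← hda, mul_assoc, had, hde]
  have e1 : d * s = e * s * d := by
    calc d * s = d * (s * e) := by rw [hse.eq, ← mul_assoc, hde]
      _ = d * (s * a) * d := by rw [← had]; simp only [mul_assoc]
      _ = e * s * d := by rw [hs.eq, ← mul_assoc, hda]
  have e2 : s * d = e * s * d := by
    rw [← hse.eq, mul_assoc, hed]
  exact e2.trans e1.symm

theorem IsDrazin.exists_pow_eq {a : A} (h : IsDrazin a) :
    ∃ (p : ℕ) (d : A), a ^ p = a ^ (p + 1) * d ∧ ∀ s, Commute s a → Commute s d := by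
  obtain ⟨p, e, d, -, had, -, -, hpe, hs⟩ := h.exists_core
  exact ⟨p, d, by rw [pow_succ, mul_assoc, had, hpe], fun s h => (hs s h).2⟩

theorem IsUnit.isDrazin {a : A} (h : IsUnit a) : IsDrazin a := by
  obtain ⟨u, rfl⟩ := h
  exact ⟨0, ↑u⁻¹, (Commute.refl (u : A)).units_inv_right, by simp⟩

theorem IsNilpotent.isDrazin {a : A} (h : IsNilpotent a) : IsDrazin a := by
  obtain ⟨n, h⟩ := h
  exact ⟨n, 0, Commute.zero_right a, by simp [h]⟩

theorem IsIdempotentElem.isDrazin {e : A} (h : IsIdempotentElem e) : IsDrazin e :=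
  ⟨1, e, Commute.refl e, by rw [IsIdempotentElem.pow_succ_eq 1 h, pow_one, h.eq]⟩

theorem IsDrazin.mul {a b : A} (ha : IsDrazin a) (hb : IsDrazin b) (hab : Commute a b) :
    IsDrazin (a * b) := by
  obtain ⟨p, x, hx, hxc⟩ := ha.exists_pow_eq
  obtain ⟨q, y, hy, hyc⟩ := hb.exists_pow_eq
  have hax := hxc a (Commute.refl a)
  have hby := hyc b (Commute.refl b)
  have hbx := hxc b hab.symm
  have hay := hyc a hab
  refine ⟨p + q, x * y, (hax.mul_right hay).mul_left (hbx.mul_right hby), ?_⟩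
  have h1 := pow_add_eq_of_pow_eq hx q
  have h2 := pow_add_eq_of_pow_eq hy p
  rw [add_comm q p] at h1
  rw [hab.mul_pow, hab.mul_pow, h1, h2, mul_assoc, mul_assoc, ← mul_assoc x, ← mul_assoc _ x,
    (hbx.pow_left _).eq, mul_assoc x]

theorem IsDrazin.of_mul_unit {a b : A} (hb : IsUnit b) (hab : Commute a b)
    (h : IsDrazin (a * b)) : IsDrazin a := by
  obtain ⟨u, rfl⟩ := hb
  have := h.mul (IsUnit.isDrazin (u⁻¹).isUnit)
    ((hab.units_inv_right).mul_left (Commute.refl _).units_inv_right)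
  simpa using this

/-- Inverses `x`, `y` of the two corners glue to `e * x + (1 - e) * y`. The common exponent `p + q +
1` dominates both and is positive, so that the powers of `e` and `1 - e` collapse. -/
theorem IsDrazin.of_split {s e : A} (he : e * e = e) (hse : Commute s e)
    (h1 : IsDrazin (s * e)) (h2 : IsDrazin (s * (1 - e))) : IsDrazin s := by
  obtain ⟨p, x, hx, hxc⟩ := h1.exists_pow_eq
  obtain ⟨q, y, hy, hyc⟩ := h2.exists_pow_eq
  have hse' : Commute s (1 - e) := (Commute.one_right s).sub_right hse
  have he' : (1 - e) * (1 - e) = 1 - e := by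
    rw [mul_sub, mul_one, sub_mul, one_mul, he]; abel
  have hsx : Commute s x := hxc s ((Commute.refl s).mul_right hse)
  have hsy : Commute s y := hyc s ((Commute.refl s).mul_right hse')
  have hpow : ∀ n, e ^ (n + 1) = e := fun n => IsIdempotentElem.pow_succ_eq n he
  have hpow' : ∀ n, (1 - e) ^ (n + 1) = 1 - e := fun n => IsIdempotentElem.pow_succ_eq n he'
  have k1 := pow_add_eq_of_pow_eq hx (q + 1)
  have k2 := pow_add_eq_of_pow_eq hy (p + 1)
  rw [show q + 1 + p = p + q + 1 by ring, hse.mul_pow, hse.mul_pow, hpow, hpow] at k1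
  rw [show p + 1 + q = p + q + 1 by ring, hse'.mul_pow, hse'.mul_pow, hpow', hpow'] at k2
  refine ⟨p + q + 1, e * x + (1 - e) * y,
    (hse.mul_right hsx).add_right (hse'.mul_right hsy), ?_⟩
  rw [mul_add, ← mul_assoc, ← mul_assoc, ← k1, ← k2, mul_sub, mul_one]
  abel

/-- Cut along the idempotent of `a`: on one corner a unit plus a commuting nilpotent is a unit, on
the other a sum of commuting nilpotents is nilpotent. -/
theorem IsDrazin.add_isNilpotent {a N : A} (ha : IsDrazin a) (hN : IsNilpotent N)
    (haN : Commute a N) : IsDrazin (a + N) := by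
  obtain ⟨p, e, d, he, had, hda, hde, hpe, hc⟩ := ha.exists_core
  obtain ⟨hae, had'⟩ := hc a (Commute.refl a)
  obtain ⟨hNe, hNd⟩ := hc N haN.symm
  have hed : e * d = d := by rw [← hda, mul_assoc, had, hde]
  have hae' : Commute a (1 - e) := (Commute.one_right a).sub_right hae
  have hNe' : Commute N (1 - e) := (Commute.one_right N).sub_right hNe
  have hcomm : Commute (a + N) e := hae.add_left hNe
  have hee' : e * (1 - e) = 0 := by rw [mul_sub, mul_one, he, sub_self]
  have he'e : (1 - e) * e = 0 := by rw [sub_mul, one_mul, he, sub_self]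
  have he' : (1 - e) * (1 - e) = 1 - e := by
    rw [mul_sub, mul_one, sub_mul, one_mul, he]; abel
  have hde' : d * (1 - e) = 0 := by rw [mul_sub, mul_one, hde, sub_self]
  have he'd : (1 - e) * d = 0 := by rw [sub_mul, one_mul, hed, sub_self]
  refine IsDrazin.of_split he hcomm ?_ ?_
  -- Filling the other corner with the identity gives a unit of the whole ring, so no corner ring is
  -- needed.
  · have hu : IsUnit (a * e + (1 - e)) := by
      refine ⟨⟨a * e + (1 - e), d + (1 - e), ?_, ?_⟩, rfl⟩
      · rw [add_mul, mul_add, mul_add, mul_assoc, hed, had, mul_assoc, hee', he'd, he']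
        simp
      · rw [add_mul, mul_add, mul_add, ← mul_assoc, hda, he, hde', hae.eq, ← mul_assoc, he'e, he']
        simp
    have hNe_nil : IsNilpotent (N * e) := hNe.isNilpotent_mul_right hN
    have hcom : Commute (N * e) (a * e + (1 - e)) := by
      refine Commute.add_right ?_ ?_
      · exact (haN.symm.mul_right hNe).mul_left (hae.symm.mul_right (Commute.refl e))
      · exact hNe'.mul_left ((Commute.one_right e).sub_right (Commute.refl e))
    have hu' := hNe_nil.isUnit_add_left_of_commute hu hcom
    have hid : (a * e + (1 - e) + N * e) * e = (a + N) * e := by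
      rw [add_mul, add_mul, mul_assoc, he, he'e, mul_assoc, he, add_zero, add_mul]
    rw [← hid]
    refine (IsUnit.isDrazin hu').mul (IsIdempotentElem.isDrazin he) ?_
    refine Commute.add_left (Commute.add_left ?_ ?_) ?_
    · exact hae.mul_left (Commute.refl e)
    · exact (Commute.one_left e).sub_left (Commute.refl e)
    · exact hNe.mul_left (Commute.refl e)
  · apply IsNilpotent.isDrazin
    rw [add_mul]
    refine Commute.isNilpotent_add ?_ ?_ ?_
    · exact (haN.mul_right hae').mul_left
        (hNe'.symm.mul_right (Commute.refl _))
    · refine ⟨p + 1, ?_⟩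
      rw [hae'.mul_pow, IsIdempotentElem.pow_succ_eq p he', pow_succ', mul_assoc, mul_sub, mul_one,
        hpe, sub_self, mul_zero]
    · exact hNe'.isNilpotent_mul_right hN

/-- If `a ^ m * b` is Drazin invertible with `a * k + b = 1`, then `a` is Drazin invertible. -/
theorem IsDrazin.of_pow_mul {a b k : A} {m : ℕ} (hm : m ≠ 0) (hab : Commute a b)
    (hak : Commute a k) (h : a * k + b = 1) (hd : IsDrazin (a ^ m * b)) : IsDrazin a := by
  obtain ⟨p, x, hx, hxc⟩ := hd.exists_pow_eq
  have hax : Commute a x := hxc a (((Commute.refl a).pow_right m).mul_right hab)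
  -- Comaximality of `a` and `b` passes to `a` and `b ^ n`. In the splitting of 1 by `b ^ p + a *
  -- w`, the first term is handled by the Drazin relation of `a ^ m * b`, while the second raises
  -- the exponent of `a` by itself.
  have hw : ∀ n : ℕ, ∃ w, Commute a w ∧ b ^ n + a * w = 1 := by
    intro n
    induction n with
    | zero => exact ⟨0, Commute.zero_right a, by simp⟩
    | succ n ih =>
      obtain ⟨w, hw, hn⟩ := ih
      refine ⟨k + b * w, hak.add_right (hab.mul_right hw), ?_⟩
      have : b * (b ^ n + a * w) = b := by rw [hn, mul_one]
      rw [mul_add, ← mul_assoc, ← hab.eq, mul_assoc] at this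
      rw [pow_succ', mul_add, add_left_comm, this, h]
  obtain ⟨w, hw, hn⟩ := hw p
  obtain ⟨m, rfl⟩ := Nat.exists_eq_succ_of_ne_zero hm
  refine ⟨(m + 1) * p, a ^ m * b ^ (p + 1) * x + w,
    ((((Commute.refl a).pow_right m).mul_right (hab.pow_right _)).mul_right hax).add_right hw, ?_⟩
  have hcm : Commute (a ^ (m + 1)) b := hab.pow_left _
  have e1 : a ^ ((m + 1) * p) * b ^ p = a ^ ((m + 1) * p + 1) * (a ^ m * b ^ (p + 1) * x) := by
    rw [pow_mul, ← hcm.mul_pow, show m.succ = m + 1 from rfl] at *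
    rw [hx, hcm.mul_pow, ← mul_assoc, ← mul_assoc, pow_succ (_ ^ _ ) p, pow_succ _ m,
      pow_succ a (_ * _), pow_mul]
    simp only [mul_assoc]
    rw [← mul_assoc (a ^ m) a, ← pow_succ, pow_succ']
    simp only [mul_assoc]
  calc a ^ ((m + 1) * p) = a ^ ((m + 1) * p) * (b ^ p + a * w) := by rw [hn, mul_one]
    _ = _ := by rw [mul_add, e1, ← mul_assoc _ a, ← pow_succ, mul_add]

end DrazinRing

/-! ### Algebraic elements and perturbations with a power of finite rank. -/

theorem isDrazin_of_aeval_eq_zero {A : Type*} [Ring A] [Algebra ℂ A] {a : A} {q : Polynomial ℂ}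
    (hq : q ≠ 0) (h : Polynomial.aeval a q = 0) : IsDrazin a := by
  -- Write q = X^j r with r(0) ≠ 0. In a^j r(a) = 0 the constant term of r can be solved for, which
  -- expresses a^j as a^(j+1) times a polynomial in a.
  obtain ⟨r, hr, hdvd⟩ := Polynomial.exists_eq_pow_rootMultiplicity_mul_and_not_dvd q hq 0
  generalize q.rootMultiplicity 0 = j at hr
  simp only [map_zero, sub_zero] at hr hdvd
  rw [Polynomial.X_dvd_iff] at hdvd
  have hsplit := Polynomial.divX_mul_X_add r
  set c := r.coeff 0 with hc
  have h1 : a ^ j * (Polynomial.aeval a r.divX * a + algebraMap ℂ A c) = 0 := by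
    rw [← h, hr]
    conv_rhs => rw [← hsplit]
    simp
  have hcom : Commute a (Polynomial.aeval a r.divX) := by
    simpa using (Polynomial.commute_X r.divX).map (Polynomial.aeval a)
  refine ⟨j, -(c⁻¹ • Polynomial.aeval a r.divX), (hcom.smul_right _).neg_right, ?_⟩
  rw [mul_add, ← hcom.eq, ← mul_assoc, ← pow_succ, add_comm, Algebra.algebraMap_eq_smul_one,
    mul_smul_comm, mul_one, add_eq_zero_iff_eq_neg] at h1
  have h2 := congrArg (fun y => c⁻¹ • y) h1
  simp only [smul_smul, inv_mul_cancel₀ hdvd, one_smul] at h2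
  rw [h2]
  simp

section Operators

variable {X : Type*} [NormedAddCommGroup X] [NormedSpace ℂ X]

/-- By Cayley-Hamilton on the range of `a ^ n`, the characteristic polynomial of the restriction
times X^n annihilates `a`. -/
theorem isDrazin_of_finiteDimensional_range_pow {a : X →L[ℂ] X} {n : ℕ}
    (h : FiniteDimensional ℂ (a ^ n).range) : IsDrazin a := by
  let b : Module.End ℂ (a ^ n).range := (a.restrict (map_mem_range_pow a n)).toLinearMap
  have hb : ∀ (q : Polynomial ℂ) (v : (a ^ n).range),
      ((Polynomial.aeval b q v : (a ^ n).range) : X) = Polynomial.aeval a q v := by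
    intro q
    induction q using Polynomial.induction_on with
    | C c => intro v; simp [Algebra.algebraMap_eq_smul_one]
    | add p q hp hq => intro v; simp [hp, hq]
    | monomial m c ih =>
      intro v
      have h1 := ih (b v)
      have h2 : ((b v : (a ^ n).range) : X) = a v := rfl
      rw [pow_succ, ← mul_assoc, map_mul (Polynomial.aeval b) _ Polynomial.X,
        map_mul (Polynomial.aeval a) _ Polynomial.X, Polynomial.aeval_X, Polynomial.aeval_X,
        Module.End.mul_apply, h1, h2]
      rfl
  refine isDrazin_of_aeval_eq_zero (q := b.charpoly * Polynomial.X ^ n)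
    (mul_ne_zero b.charpoly_monic.ne_zero (pow_ne_zero _ Polynomial.X_ne_zero)) ?_
  ext x
  have := hb b.charpoly ⟨(a ^ n) x, ⟨x, rfl⟩⟩
  rw [LinearMap.aeval_self_charpoly] at this
  simpa using this.symm

theorem finiteDimensional_range_of_mul_eq {a b c : X →L[ℂ] X} (h : FiniteDimensional ℂ a.range)
    (hc : c = a * b) : FiniteDimensional ℂ c.range := by
  refine Submodule.finiteDimensional_of_le (S₂ := a.range) ?_
  rintro _ ⟨x, rfl⟩
  exact ⟨b x, by rw [hc]; rfl⟩

/-- Drazin invertibility is stable under commuting perturbations with a power of finite rank. -/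
theorem IsDrazin.add_of_finiteDimensional_range_pow {t F : X →L[ℂ] X} (ht : IsDrazin t)
    (htF : Commute t F) {n : ℕ} (hF : FiniteDimensional ℂ (F ^ n).range) : IsDrazin (t + F) := by
  obtain ⟨p, e, d, he, hFd, hdF, hde, hpe, hc⟩ :=
    (isDrazin_of_finiteDimensional_range_pow hF).exists_core
  have hte := (hc t htF).1
  have hFe := (hc F (Commute.refl F)).1
  have hFd' := (hc F (Commute.refl F)).2
  have hte' : Commute t (1 - e) := (Commute.one_right t).sub_right hte
  have hFe' : Commute F (1 - e) := (Commute.one_right F).sub_right hFe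
  have he' : (1 - e) * (1 - e) = 1 - e := by
    rw [mul_sub, mul_one, sub_mul, one_mul, he]; abel
  refine IsDrazin.of_split he (hte.add_left hFe) ?_ ?_
  -- The idempotent of F factors through `F ^ n`, so this corner of `t + F` has finite rank. On the
  -- other corner F is nilpotent.
  · have hew : ∃ w, e = F ^ n * w := by
      cases n with
      | zero => exact ⟨e, by simp⟩
      | succ n =>
        refine ⟨d ^ (n + 1), ?_⟩
        rw [← hFd'.mul_pow, hFd, IsIdempotentElem.pow_succ_eq n he]
    obtain ⟨w, hw⟩ := hew
    apply isDrazin_of_finiteDimensional_range_pow (n := 1)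
    apply finiteDimensional_range_of_mul_eq (b := w * (t + F)) hF
    rw [pow_one, ← mul_assoc, ← hw]
    exact (hte.add_left hFe).eq
  · rw [add_mul]
    refine (ht.mul (IsIdempotentElem.isDrazin he') hte').add_isNilpotent ⟨p + 1, ?_⟩ ?_
    · rw [hFe'.mul_pow, IsIdempotentElem.pow_succ_eq p he', pow_succ', mul_assoc, mul_sub, mul_one,
        hpe, sub_self, mul_zero]
    · exact (htF.mul_right hte').mul_left (hFe'.symm.mul_right (Commute.refl _))

end Operators

/-! ### Drazin invertible translates and poles of the resolvent. -/

section Resolvent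

theorem commute_ringInverse {M : Type*} [MonoidWithZero M] {s x : M} (h : Commute s x) :
    Commute s (Ring.inverse x) := by
  by_cases hx : IsUnit x
  · obtain ⟨u, rfl⟩ := hx
    rw [Ring.inverse_unit]
    exact h.units_inv_right
  · rw [Ring.inverse_non_unit _ hx]
    exact Commute.zero_right s

variable {A : Type*} [NormedRing A] [NormedAlgebra ℂ A]

theorem resolvent_mul_sub {a : A} {z : ℂ} (hz : z ∉ spectrum ℂ a) :
    resolvent a z * (algebraMap ℂ A z - a) = 1 :=
  Ring.inverse_mul_cancel _ (spectrum.notMem_iff.mp hz)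

theorem sub_mul_resolvent {a : A} {z : ℂ} (hz : z ∉ spectrum ℂ a) :
    (algebraMap ℂ A z - a) * resolvent a z = 1 :=
  Ring.mul_inverse_cancel _ (spectrum.notMem_iff.mp hz)

theorem commute_resolvent {s a : A} (h : Commute s a) (z : ℂ) : Commute s (resolvent a z) :=
  commute_ringInverse (Commute.sub_right (Algebra.commutes z s).symm h)

theorem commute_sub_algebraMap {s a : A} (h : Commute s a) (z : ℂ) :
    Commute s (a - algebraMap ℂ A z) :=
  h.sub_right (Algebra.commutes z s).symm

theorem isDrazin_sub_algebraMap_of_notMem_spectrum {a : A} {z : ℂ} (hz : z ∉ spectrum ℂ a) :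
    IsDrazin (a - algebraMap ℂ A z) := by
  apply IsUnit.isDrazin
  rw [← neg_sub, IsUnit.neg_iff]
  exact spectrum.notMem_iff.mp hz

/-- This replaces a comparison of Laurent coefficients. For k > 0 the limit w → 0 gives c = g(0) t.
Subtracting this and dividing by w yields the same identity for the divided difference of g, with k
lowered by one and g(0) as new c, killed by one more power of t. For k = 0 the limit identity times
t^j is the Drazin relation. -/
theorem isDrazin_of_eventually_mul_sub_add_eq {t : A} {j : ℕ} (k : ℕ) {g : ℂ → A} {c : A}
    (hg : AnalyticAt ℂ g 0) (hc : c * t ^ j = 0)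
    (hgt : ∀ᶠ w in 𝓝[≠] (0 : ℂ), Commute t (g w))
    (h : ∀ᶠ w in 𝓝[≠] (0 : ℂ), g w * (algebraMap ℂ A w - t) + c = algebraMap ℂ A (w ^ k)) :
    IsDrazin t := by
  have key : ∀ (k : ℕ) {g : ℂ → A} {c : A}, AnalyticAt ℂ g 0 →
      (∀ᶠ w in 𝓝[≠] (0 : ℂ), Commute t (g w)) →
      (∀ᶠ w in 𝓝[≠] (0 : ℂ), g w * (algebraMap ℂ A w - t) + c = algebraMap ℂ A (w ^ k)) →
      Commute t (g 0) ∧ g 0 * (0 - t) + c = algebraMap ℂ A (0 ^ k) := by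
    intro k g c hg hgt h
    have hcont : Tendsto g (𝓝[≠] 0) (𝓝 (g 0)) := hg.continuousAt.tendsto.mono_left inf_le_left
    have hid : ∀ k : ℕ, Tendsto (fun w : ℂ => algebraMap ℂ A (w ^ k)) (𝓝[≠] 0)
        (𝓝 (algebraMap ℂ A (0 ^ k))) := fun k =>
      (((algebraMapCLM ℂ A).continuous.comp (continuous_pow k)).tendsto (0 : ℂ)).mono_left
        inf_le_left
    have hid1 := hid 1
    simp only [pow_one, map_zero] at hid1
    exact ⟨tendsto_nhds_unique_of_eventuallyEq (hcont.const_mul t) (hcont.mul_const t) hgt,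
      tendsto_nhds_unique_of_eventuallyEq ((hcont.mul (hid1.sub_const t)).add_const c) (hid k) h⟩
  induction k generalizing g c j with
  | zero =>
    obtain ⟨h0, h1⟩ := key 0 hg hgt h
    rw [pow_zero, map_one] at h1
    refine ⟨j, -g 0, h0.neg_right, ?_⟩
    have h2 : (g 0 * (0 - t) + c) * t ^ j = t ^ j := by rw [h1, one_mul]
    rw [add_mul, hc, add_zero, zero_sub, mul_neg, ← h0.eq] at h2
    conv_lhs => rw [← h2]
    rw [mul_neg, pow_succ', mul_assoc, (h0.pow_left j).eq, neg_mul, mul_assoc]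
  | succ k ih =>
    obtain ⟨h0, h1⟩ := key (k + 1) hg hgt h
    rw [zero_pow k.succ_ne_zero, map_zero, zero_sub, mul_neg, neg_add_eq_zero] at h1
    obtain ⟨q, hq⟩ := hg
    have hg' : ∀ w ≠ (0 : ℂ), g w = g 0 + algebraMap ℂ A w * dslope g 0 w := by
      intro w hw
      have := sub_smul_dslope g 0 w
      rw [sub_zero, Algebra.smul_def] at this
      rw [this]; abel
    refine ih (g := dslope g 0) (c := g 0) (j := j + 1) hq.has_fpower_series_dslope_fslope.analyticAt ?_ ?_ ?_
    · rw [pow_succ', ← mul_assoc, h1, hc]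
    · filter_upwards [hgt, self_mem_nhdsWithin] with w hw hw0
      rw [dslope_of_ne _ hw0, slope_def_module]
      exact (hw.sub_right h0).smul_right _
    · filter_upwards [h, self_mem_nhdsWithin] with w hw hw0
      have hw0 : w ≠ 0 := hw0
      have e1 : algebraMap ℂ A w * (dslope g 0 w * (algebraMap ℂ A w - t) + g 0)
          = algebraMap ℂ A w * algebraMap ℂ A (w ^ k) := by
        rw [← map_mul, ← pow_succ', ← hw, hg' w hw0, ← h1, mul_add, ← mul_assoc, add_mul, mul_sub (g 0),
          ← Algebra.commutes w (g 0)]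
        abel
      have hu : IsUnit (algebraMap ℂ A w) := (IsUnit.mk0 w hw0).map _
      exact hu.mul_left_cancel e1

theorem isDrazin_of_meromorphicAt_resolvent {a : A} {l : ℂ}
    (hl : ∀ᶠ z in 𝓝[≠] l, z ∉ spectrum ℂ a) (hm : MeromorphicAt (resolvent a) l) :
    IsDrazin (a - algebraMap ℂ A l) := by
  obtain ⟨n, hn⟩ := hm
  have htend : Tendsto (fun w : ℂ => w + l) (𝓝[≠] 0) (𝓝[≠] l) := by
    refine tendsto_nhdsWithin_of_tendsto_nhds_of_eventually_within _ ?_ ?_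
    · have : Tendsto (fun w : ℂ => w + l) (𝓝 0) (𝓝 (0 + l)) :=
        (continuous_add_const l).tendsto 0
      rw [zero_add] at this
      exact this.mono_left inf_le_left
    · filter_upwards [self_mem_nhdsWithin] with w hw
      simpa using hw
  refine isDrazin_of_eventually_mul_sub_add_eq (j := 0) n
    (g := fun w => (w + l - l) ^ n • resolvent a (w + l)) (c := 0) ?_ (by simp) ?_ ?_
  · have hn' : AnalyticAt ℂ (fun z => (z - l) ^ n • resolvent a z) ((0 : ℂ) + l) := by
      rwa [zero_add]
    exact hn'.comp (f := fun w : ℂ => w + l) (by fun_prop)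
  · refine Eventually.of_forall fun w => Commute.smul_right ?_ _
    exact commute_resolvent ((Commute.refl a).sub_left (Algebra.commutes l a)) _
  · filter_upwards [htend.eventually hl] with w hw
    have := resolvent_mul_sub hw
    rw [add_zero, add_sub_cancel_right, smul_mul_assoc, sub_sub_eq_add_sub, ← map_add, this,
      Algebra.algebraMap_eq_smul_one]

variable [CompleteSpace A]

/-- The Laurent expansion is explicit. With w = z - l, the inverse of w - t is -d (1 - w d)⁻¹ on the
core and, on the nilpotent corner, the finite sum of w^(-i-1) t^i for i < p. -/
theorem IsDrazin.exists_analyticAt {a : A} {l : ℂ} (h : IsDrazin (a - algebraMap ℂ A l)) :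
    (∀ᶠ z in 𝓝[≠] l, z ∉ spectrum ℂ a) ∧ MeromorphicAt (resolvent a) l := by
  set t := a - algebraMap ℂ A l with ht
  obtain ⟨p, e, d, he, htd, hdt, hde, hpe, hc⟩ := h.exists_core
  have hte := (hc t (Commute.refl t)).1
  have htd' := (hc t (Commute.refl t)).2
  have hpe' : t ^ p * (1 - e) = 0 := by rw [mul_sub, mul_one, hpe, sub_self]
  have hed : e * d = d := by rw [← hdt, mul_assoc, htd, hde]
  let B : ℂ → A := fun z => Ring.inverse (1 - (z - l) • d)
  let Y : ℂ → A := fun z =>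
    -(d * B z) + ∑ i ∈ Finset.range p, ((z - l)⁻¹) ^ (i + 1) • (t ^ i * (1 - e))
  have hB : ∀ᶠ z in 𝓝 l, IsUnit (1 - (z - l) • d) := by
    have hcont : ContinuousAt (fun z : ℂ => 1 - (z - l) • d) l := by fun_prop
    refine hcont.eventually_mem (Units.isOpen.mem_nhds ?_)
    simp
  have hYR : ∀ᶠ z in 𝓝[≠] l, (algebraMap ℂ A z - a) * Y z = 1 ∧ Y z * (algebraMap ℂ A z - a) = 1 := by
    filter_upwards [hB.filter_mono inf_le_left, self_mem_nhdsWithin] with z hz hzl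
    have hzl : z - l ≠ 0 := sub_ne_zero.mpr hzl
    set w := z - l with hw
    have hza : algebraMap ℂ A z - a = algebraMap ℂ A w - t := by
      rw [hw, ht, map_sub]; abel
    have htB : Commute t (B z) := by
      apply commute_ringInverse
      exact (Commute.one_right t).sub_right (htd'.smul_right _)
    have htY : Commute t (Y z) := by
      refine Commute.add_right (htd'.mul_right htB).neg_right ?_
      refine Commute.sum_right _ _ _ fun i _ => Commute.smul_right ?_ _
      exact ((Commute.refl t).pow_right i).mul_right ((Commute.one_right t).sub_right hte)
    have hcomm : Commute (algebraMap ℂ A w - t) (Y z) :=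
      Commute.sub_left (Algebra.commutes w _) htY
    have h1 : (algebraMap ℂ A w - t) * (-(d * B z)) = e := by
      have : (1 - w • d) * B z = 1 := Ring.mul_inverse_cancel _ hz
      calc (algebraMap ℂ A w - t) * (-(d * B z)) = e * ((1 - w • d) * B z) := by
            rw [← mul_assoc, mul_sub, mul_one, mul_smul_comm, hed, mul_neg, ← mul_assoc,
              sub_mul (algebraMap ℂ A w), htd, ← Algebra.smul_def, sub_mul, sub_mul]
            abel
        _ = e := by rw [this, mul_one]
    have h2 : (algebraMap ℂ A w - t) *
        ∑ i ∈ Finset.range p, (w⁻¹) ^ (i + 1) • (t ^ i * (1 - e)) = 1 - e := by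
      have : ∀ n, (algebraMap ℂ A w - t) *
          ∑ i ∈ Finset.range n, (w⁻¹) ^ (i + 1) • (t ^ i * (1 - e)) =
            1 - e - (w⁻¹) ^ n • (t ^ n * (1 - e)) := by
        intro n
        induction n with
        | zero => simp
        | succ n ih =>
          rw [Finset.sum_range_succ, mul_add, ih, sub_mul, mul_smul_comm _ t, ← mul_assoc t,
            ← pow_succ', ← Algebra.smul_def, smul_smul, pow_succ' w⁻¹ n, ← mul_assoc,
            mul_inv_cancel₀ hzl, one_mul]
          abel
      rw [this p, hpe', smul_zero, sub_zero]
    have h3 : (algebraMap ℂ A w - t) * Y z = 1 := by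
      change _ * (-(d * B z) + ∑ i ∈ Finset.range p, (w⁻¹) ^ (i + 1) • (t ^ i * (1 - e))) = 1
      rw [mul_add, h1, h2]; abel
    rw [hza]
    exact ⟨h3, by rw [← hcomm.eq, h3]⟩
  refine ⟨?_, ?_⟩
  · filter_upwards [hYR] with z hz
    rw [spectrum.notMem_iff]
    exact ⟨⟨_, Y z, hz.1, hz.2⟩, rfl⟩
  · have hY : MeromorphicAt Y l := by
      refine MeromorphicAt.add ?_ ?_
      · refine AnalyticAt.meromorphicAt (AnalyticAt.neg (analyticAt_const.mul ?_))
        have h1 : AnalyticAt ℂ (Ring.inverse : A → A) (1 - (l - l) • d) := by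
          rw [sub_self, zero_smul, sub_zero]
          exact analyticAt_inverse (1 : Aˣ)
        exact h1.comp (f := fun z : ℂ => 1 - (z - l) • d) (by fun_prop)
      · refine MeromorphicAt.fun_sum fun i _ => ?_
        have h1 : MeromorphicAt (fun z : ℂ => z - l) l := AnalyticAt.meromorphicAt (by fun_prop)
        exact (h1.inv.pow (i + 1)).smul (MeromorphicAt.const (t ^ i * (1 - e)) l)

    refine hY.congr ?_
    filter_upwards [hYR] with z hz
    exact (Ring.inverse_unit (⟨_, Y z, hz.1, hz.2⟩ : Aˣ)).symm

/-- If the order were nonnegative, the resolvent would have a limit at `l`, and that limit would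
invert `l - a`. -/
theorem isPole_resolvent_of_mem_spectrum {a : A} {l : ℂ} (hl : l ∈ spectrum ℂ a)
    (h : IsDrazin (a - algebraMap ℂ A l)) : IsPole (resolvent a) l := by
  obtain ⟨h1, h2⟩ := h.exists_analyticAt
  refine ⟨h2, ?_⟩
  by_contra hneg
  obtain ⟨c, hc⟩ := tendsto_nhds_of_meromorphicOrderAt_nonneg h2 (not_lt.mp hneg)
  have hid : Tendsto (fun z : ℂ => algebraMap ℂ A z - a) (𝓝[≠] l) (𝓝 (algebraMap ℂ A l - a)) :=
    (((algebraMapCLM ℂ A).continuous.tendsto l).mono_left inf_le_left).sub_const a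
  refine hl (spectrum.mem_resolventSet_iff.mpr ⟨⟨_, c, ?_, ?_⟩, rfl⟩)
  · exact tendsto_nhds_unique_of_eventuallyEq (hid.mul hc) tendsto_const_nhds
      (h1.mono fun z hz => sub_mul_resolvent hz)
  · exact tendsto_nhds_unique_of_eventuallyEq (hc.mul hid) tendsto_const_nhds
      (h1.mono fun z hz => resolvent_mul_sub hz)

end Resolvent

section Operators

variable {X : Type*} [NormedAddCommGroup X] [NormedSpace ℂ X] [CompleteSpace X]

theorem smul_id_eq_algebraMap {X : Type*} [NormedAddCommGroup X] [NormedSpace ℂ X] (l : ℂ) :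
    l • ContinuousLinearMap.id ℂ X = algebraMap ℂ (X →L[ℂ] X) l :=
  (Algebra.algebraMap_eq_smul_one l).symm

/-- This carries all later uses of meromorphy. The accumulation condition is absorbed because a
Drazin point has a punctured neighbourhood in the resolvent set. -/
theorem isMeromorphic_iff {S : X →L[ℂ] X} :
    IsMeromorphic S ↔ ∀ l : ℂ, l ≠ 0 → IsDrazin (S - algebraMap ℂ (X →L[ℂ] X) l) := by
  constructor
  · rintro ⟨h1, h2⟩ l hl
    by_cases hs : l ∈ spectrum ℂ S
    · have hacc : ¬ AccPt l (𝓟 (spectrum ℂ S)) := fun h => hl (h1 l h)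
      refine isDrazin_of_meromorphicAt_resolvent ?_ (h2 l hs hl hacc).1
      rwa [accPt_iff_frequently_nhdsNE, not_frequently] at hacc
    · exact isDrazin_sub_algebraMap_of_notMem_spectrum hs
  · intro h
    refine ⟨fun l hl => ?_, fun l hl hl0 _ => isPole_resolvent_of_mem_spectrum hl (h l hl0)⟩
    by_contra hl0
    rw [accPt_iff_frequently_nhdsNE] at hl
    exact hl (h l hl0).exists_analyticAt.1

end Operators

/-! ### B-Fredholm operators and the comparison of the two spectra. -/

section Fredholm

variable {X : Type*} [NormedAddCommGroup X] [NormedSpace ℂ X]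

theorem isFredholm_of_mul_eq_one {s r : X →L[ℂ] X} (h1 : s * r = 1) (h2 : r * s = 1) :
    s.IsFredholm := by
  refine ContinuousLinearMap.IsFredholm.of_isQuasiInverse (v := r) ⟨?_, ?_⟩
  · have : (r : X →ₗ[ℂ] X) ∘ₗ (s : X →ₗ[ℂ] X) = LinearMap.id :=
      congrArg ContinuousLinearMap.toLinearMap h2
    rw [LinearMap.IsLeftQuasiInverse, this]
  · have : (s : X →ₗ[ℂ] X) ∘ₗ (r : X →ₗ[ℂ] X) = LinearMap.id :=
      congrArg ContinuousLinearMap.toLinearMap h1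
    rw [LinearMap.IsRightQuasiInverse, this]

theorem isFredholm_pow {s : X →L[ℂ] X} (hs : s.IsFredholm) (k : ℕ) : (s ^ k).IsFredholm := by
  induction k with
  | zero => exact isFredholm_of_mul_eq_one (r := 1) (by simp) (by simp)
  | succ k ih =>
    obtain ⟨v, hv⟩ := ih.exists_isQuasiInverse
    obtain ⟨u, hu⟩ := hs.exists_isQuasiInverse
    have := hu.comp hv
    refine ContinuousLinearMap.IsFredholm.of_isQuasiInverse (v := u * v) ?_
    exact this

/-- The range of `t ^ (p + 1)` is that of the idempotent `e`, hence closed, and `t` is inverted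
there by `d`. The exponent `p + 1` also covers `p = 0`. -/
theorem IsDrazin.isBFredholm {t : X →L[ℂ] X} (h : IsDrazin t) : IsBFredholm t := by
  obtain ⟨p, e, d, he, htd, hdt, hde, hpe, hc⟩ := h.exists_core
  have htd' := (hc t (Commute.refl t)).2
  have hte := (hc t (Commute.refl t)).1
  have hpe1 : t ^ (p + 1) * e = t ^ (p + 1) := by rw [pow_succ', mul_assoc, hpe]
  have heq : e = t ^ (p + 1) * d ^ (p + 1) := by
    rw [← htd'.mul_pow, htd, IsIdempotentElem.pow_succ_eq p he]
  have hmem : ∀ x, x ∈ (t ^ (p + 1)).range ↔ e x = x := by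
    intro x
    constructor
    · rintro ⟨y, rfl⟩
      change (e * t ^ (p + 1)) y = (t ^ (p + 1)) y
      rw [← (hte.pow_left _).eq, hpe1]
    · intro hx
      refine ⟨(d ^ (p + 1)) x, ?_⟩
      change (t ^ (p + 1) * d ^ (p + 1)) x = x
      rw [← heq, hx]
  refine ⟨p + 1, ?_, ?_⟩
  · have : ((t ^ (p + 1)).range : Set X) = {x | e x = x} := by ext x; exact hmem x
    rw [this]
    exact isClosed_eq e.continuous continuous_id
  · have hd : ∀ x ∈ (t ^ (p + 1)).range, d x ∈ (t ^ (p + 1)).range := by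
      intro x hx
      rw [hmem] at hx ⊢
      change (e * d) x = d x
      rw [← hdt, mul_assoc, htd, hde]
    refine isFredholm_of_mul_eq_one (r := d.restrict hd) ?_ ?_
    · ext x
      change (t * d) (x : X) = x
      rw [htd, (hmem x).mp x.2]
    · ext x
      change (d * t) (x : X) = x
      rw [hdt, (hmem x).mp x.2]

/-- `0` is a limit of non-zero scalars `w` with `u - w` invertible. -/
def IsLimitOfUnits (u : X →L[ℂ] X) : Prop :=
  ∀ ε > 0, ∃ w : ℂ, w ≠ 0 ∧ ‖w‖ < ε ∧ IsUnit (u - algebraMap ℂ (X →L[ℂ] X) w)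

theorem IsLimitOfUnits.exists_inverse {u : X →L[ℂ] X} (h : IsLimitOfUnits u) {ε : ℝ} (hε : 0 < ε) :
    ∃ (w : ℂ) (r : X →L[ℂ] X), ‖w‖ < ε ∧ (∀ x, u (r x) - w • r x = x) ∧
      ∀ x, r (u x) - w • r x = x := by
  obtain ⟨w, -, hw, ⟨v, hv⟩⟩ := h ε hε
  refine ⟨w, ↑v⁻¹, hw, fun x => ?_, fun x => ?_⟩
  · have h1 := v.mul_inv
    rw [hv] at h1
    simpa [Algebra.algebraMap_eq_smul_one] using congrArg (fun f : X →L[ℂ] X => f x) h1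
  · have h1 := v.inv_mul
    rw [hv] at h1
    simpa [Algebra.algebraMap_eq_smul_one] using congrArg (fun f : X →L[ℂ] X => f x) h1

variable [CompleteSpace X]

/-- The open mapping theorem bounds preimages by a constant C. For |w| < 1/(4C) this forces ‖(u -
w)⁻¹‖ ≤ 2C, and a kernel vector x = -w (u - w)⁻¹ x then satisfies ‖x‖ ≤ ‖x‖/2. -/
theorem IsLimitOfUnits.isUnit_of_surjective {u : X →L[ℂ] X} (h : IsLimitOfUnits u)
    (hu : Function.Surjective u) : IsUnit u := by
  rw [ContinuousLinearMap.isUnit_iff_bijective]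
  refine ⟨?_, hu⟩
  obtain ⟨C, hC, hpre⟩ := u.exists_preimage_norm_le hu
  obtain ⟨w, r, hw, h1, h2⟩ := h.exists_inverse (show 0 < 1 / (4 * C) by positivity)
  have hwC : ‖w‖ * C ≤ 1 / 4 := by
    rw [lt_div_iff₀ (by positivity)] at hw
    linarith
  have hr : ‖r‖ ≤ 2 * C := by
    have hr' : ‖r‖ ≤ C + ‖w‖ * ‖r‖ * C := by
      refine r.opNorm_le_bound (by positivity) fun y => ?_
      obtain ⟨x, rfl, hx⟩ := hpre y
      have e1 : r (u x) = x + w • r x := by rw [← sub_eq_iff_eq_add]; exact h2 x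
      calc ‖r (u x)‖ ≤ ‖x‖ + ‖w‖ * ‖r x‖ := by
            rw [e1, ← norm_smul]; exact norm_add_le _ _
        _ ≤ ‖x‖ + ‖w‖ * (‖r‖ * ‖x‖) := by gcongr; exact r.le_opNorm x
        _ = (1 + ‖w‖ * ‖r‖) * ‖x‖ := by ring
        _ ≤ (1 + ‖w‖ * ‖r‖) * (C * ‖u x‖) := by gcongr
        _ = _ := by ring
    nlinarith [norm_nonneg r]
  rw [injective_iff_map_eq_zero]
  intro x hx
  have e1 : x = -(w • r x) := by
    have := h2 x
    rw [hx, map_zero, zero_sub] at this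
    exact this.symm
  have e2 : ‖x‖ ≤ ‖w‖ * (2 * C * ‖x‖) := by
    calc ‖x‖ = ‖w‖ * ‖r x‖ := by conv_lhs => rw [e1, norm_neg, norm_smul]
      _ ≤ _ := by gcongr; exact r.le_of_opNorm_le hr x
  have : ‖x‖ ≤ 0 := by nlinarith [norm_nonneg x]
  exact norm_le_zero_iff.mp this

/-- Injectivity and closed range bound u below, so r = (u - w)⁻¹ satisfies ‖r y‖ ≤ 2K‖y‖ for small
w. Then u(r y) = y + w r y tends to y, and the range is dense as well as closed. -/
theorem IsLimitOfUnits.isUnit_of_injective {u : X →L[ℂ] X} (h : IsLimitOfUnits u)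
    (hu : Function.Injective u) (hcl : IsClosed (Set.range u)) : IsUnit u := by
  rw [ContinuousLinearMap.isUnit_iff_bijective]
  refine ⟨hu, fun y => ?_⟩
  obtain ⟨K, hK⟩ := u.antilipschitz_of_injective_of_isClosed_range hu hcl
  have hK' : ∀ x, ‖x‖ ≤ K * ‖u x‖ := fun x => by
    simpa using hK.le_mul_dist x 0
  suffices y ∈ closure (Set.range u) by rwa [hcl.closure_eq] at this
  rw [Metric.mem_closure_range_iff]
  intro ε hε
  obtain ⟨w, r, hw, h1, h2⟩ := h.exists_inverse
    (show 0 < min (1 / (2 * ((K : ℝ) + 1))) (ε / (2 * K * ‖y‖ + 1)) by positivity)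
  rw [lt_min_iff] at hw
  obtain ⟨hw1, hw2⟩ := hw
  rw [lt_div_iff₀ (by positivity)] at hw1 hw2
  have e1 : u (r y) = y + w • r y := by rw [← sub_eq_iff_eq_add]; exact h1 y
  have hry : ‖r y‖ ≤ 2 * K * ‖y‖ := by
    have := hK' (r y)
    rw [e1] at this
    have h3 : ‖y + w • r y‖ ≤ ‖y‖ + ‖w‖ * ‖r y‖ := by
      rw [← norm_smul]; exact norm_add_le _ _
    have h4 : (K : ℝ) * ‖w‖ * ‖r y‖ ≤ 1 / 2 * ‖r y‖ := by
      gcongr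
      nlinarith [norm_nonneg w]
    have h5 : (K : ℝ) * ‖y + w • r y‖ ≤ K * (‖y‖ + ‖w‖ * ‖r y‖) := by gcongr
    nlinarith
  refine ⟨r y, ?_⟩
  rw [e1, dist_self_add_right, norm_smul]
  calc ‖w‖ * ‖r y‖ ≤ ‖w‖ * (2 * K * ‖y‖) := by gcongr
    _ < ε := by nlinarith [norm_nonneg w]

-- Invariance under u alone does not make N invariant under (u - w)⁻¹. The second hypothesis
-- supplies this, and ranges of powers satisfy it only for w ≠ 0, whence that clause in
-- `IsLimitOfUnits`.
omit [CompleteSpace X] in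
theorem IsLimitOfUnits.restrict {u : X →L[ℂ] X} (h : IsLimitOfUnits u) {N : Submodule ℂ X}
    (hN : ∀ x ∈ N, u x ∈ N) (hw : ∀ w : ℂ, w ≠ 0 → ∀ x, u x - w • x ∈ N → x ∈ N) :
    IsLimitOfUnits (u.restrict hN) := by
  intro ε hε
  obtain ⟨w, hw0, hwε, ⟨v, hv⟩⟩ := h ε hε
  have h1 := v.mul_inv
  have h2 := v.inv_mul
  rw [hv] at h1 h2
  generalize ((v⁻¹ : (X →L[ℂ] X)ˣ) : X →L[ℂ] X) = r at h1 h2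
  have h1' : ∀ x, u (r x) - w • r x = x := fun x => by
    simpa [Algebra.algebraMap_eq_smul_one] using congrArg (fun f : X →L[ℂ] X => f x) h1
  have h2' : ∀ x, r (u x) - w • r x = x := fun x => by
    simpa [Algebra.algebraMap_eq_smul_one] using congrArg (fun f : X →L[ℂ] X => f x) h2
  have hr : ∀ x ∈ N, r x ∈ N := fun x hx => hw w hw0 _ (by rwa [h1'])
  refine ⟨w, hw0, hwε, ⟨⟨_, r.restrict hr, ?_, ?_⟩, rfl⟩⟩
  · ext x
    simpa [Algebra.algebraMap_eq_smul_one] using h1' x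
  · ext x
    simpa [Algebra.algebraMap_eq_smul_one] using h2' x

omit [CompleteSpace X] in
theorem mem_range_pow_of_sub_smul_mem {t : X →L[ℂ] X} {n : ℕ} {w : ℂ} (hw : w ≠ 0) {x : X}
    (hx : t x - w • x ∈ (t ^ n).range) : x ∈ (t ^ n).range := by
  induction n with
  | zero => exact ⟨x, by simp⟩
  | succ n ih =>
    have h1 : x ∈ (t ^ n).range := by
      refine ih ?_
      obtain ⟨y, hy⟩ := hx
      exact ⟨t y, by rw [← hy, pow_succ]; rfl⟩
    have h2 : t x ∈ (t ^ (n + 1)).range := by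
      obtain ⟨y, hy⟩ := h1
      exact ⟨y, by rw [← hy, pow_succ']; rfl⟩
    have h3 : w • x ∈ (t ^ (n + 1)).range := by
      have := Submodule.sub_mem _ h2 hx
      rwa [sub_sub_cancel] at this
    have h4 := Submodule.smul_mem _ w⁻¹ h3
    rwa [smul_smul, inv_mul_cancel₀ hw, one_smul] at h4

omit [CompleteSpace X] in
theorem antitone_range_pow (t : X →L[ℂ] X) : Antitone fun n : ℕ => (t ^ n).range := by
  refine antitone_nat_of_succ_le fun n => ?_
  rintro _ ⟨y, rfl⟩
  exact ⟨t y, by rw [pow_succ]; rfl⟩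

omit [CompleteSpace X] in
theorem IsDrazin.of_restrict_range_pow {t : X →L[ℂ] X} {n : ℕ}
    (h : IsDrazin (t.restrict (map_mem_range_pow t n))) : IsDrazin t := by
  set s := t.restrict (map_mem_range_pow t n) with hs
  obtain ⟨q, e, d, he, hsd, hds, hde, hqe, hc⟩ := h.exists_core
  have hsd' : Commute s d := (hc s (Commute.refl s)).2
  let π : X →L[ℂ] (t ^ n).range := (t ^ n).codRestrict _ fun x => ⟨x, rfl⟩
  let ι : (t ^ n).range →L[ℂ] X := (t ^ n).range.subtypeL
  have hιs : ∀ (k : ℕ) (y : (t ^ n).range), (t ^ k) (ι y) = ι ((s ^ k) y) := by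
    intro k
    induction k with
    | zero => intro y; simp
    | succ k ih =>
      intro y
      rw [pow_succ, pow_succ]
      exact ih (s y)
  have hπ : ∀ x, π (t x) = s (π x) := by
    intro x
    ext
    change (t ^ n * t) x = (t * t ^ n) x
    rw [← pow_succ, ← pow_succ']
  -- The map `π` is `t ^ n` into its range. Of the `n + 1` factors `d`, `n` undo that power on the
  -- core and one serves as the inverse.
  refine ⟨q + n, ι ∘L (d ^ (n + 1)) ∘L π, ?_, ?_⟩
  · ext x
    change t (ι ((d ^ (n + 1)) (π x))) = ι ((d ^ (n + 1)) (π (t x)))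
    have h1 := hιs 1 ((d ^ (n + 1)) (π x))
    rw [pow_one, pow_one] at h1
    rw [h1, hπ]
    have h2 : (s * d ^ (n + 1)) (π x) = (d ^ (n + 1) * s) (π x) := by
      rw [(hsd'.pow_right (n + 1)).eq]
    exact congrArg ι h2
  · ext x
    change (t ^ (q + n)) x = (t ^ (q + n + 1)) (ι ((d ^ (n + 1)) (π x)))
    rw [hιs, pow_add]
    change (t ^ q) (ι (π x)) = _
    rw [hιs]
    have h2 : s ^ q = s ^ (q + n + 1) * d ^ (n + 1) := by
      rw [add_assoc, pow_add, mul_assoc, ← hsd'.mul_pow, hsd, IsIdempotentElem.pow_succ_eq n he,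
        hqe]
    rw [h2]
    rfl

/-- A Fredholm operator that is a limit of invertible translates is Drazin invertible. -/
theorem IsLimitOfUnits.isDrazin_of_isFredholm {s : X →L[ℂ] X} (h : IsLimitOfUnits s)
    (hs : s.IsFredholm) : IsDrazin s := by
  have hclosed : ∀ k : ℕ, IsClosed ((s ^ k).range : Set X) := fun k =>
    (isFredholm_pow hs k).isClosed_range
  have hanti := antitone_range_pow s
  have hfin := hs.finite_ker
  -- The kernel is finite-dimensional, so its decreasing intersections with the ranges of the powers
  -- become stationary.
  obtain ⟨K, hK⟩ : ∃ K : ℕ, ∀ k ≥ K, ∀ x, s x = 0 → x ∈ (s ^ K).range → x ∈ (s ^ k).range := by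
    let f : ℕ →o (Submodule ℂ s.ker)ᵒᵈ :=
      ⟨fun k => OrderDual.toDual ((s ^ k).range.comap s.ker.subtype), fun i j hij =>
        Submodule.comap_mono (hanti hij)⟩
    obtain ⟨K, hK⟩ := IsArtinian.monotone_stabilizes f
    refine ⟨K, fun k hk x hx hxK => ?_⟩
    have h1 : (s ^ K).range.comap s.ker.subtype = (s ^ k).range.comap s.ker.subtype := hK k hk
    have h2 : (⟨x, hx⟩ : s.ker) ∈ (s ^ K).range.comap s.ker.subtype := hxK
    rw [h1] at h2
    exact h2
  let M : Submodule ℂ X := ⨅ k : ℕ, (s ^ k).range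
  have hMmem : ∀ x, x ∈ M ↔ ∀ k : ℕ, x ∈ (s ^ k).range := fun x => Submodule.mem_iInf _
  have hM : ∀ x ∈ M, s x ∈ M := fun x hx => by
    rw [hMmem] at hx ⊢
    exact fun k => map_mem_range_pow s k x (hx k)
  have hMclosed : IsClosed (M : Set X) := by
    rw [Submodule.coe_iInf]
    exact isClosed_iInter hclosed
  have hMcomplete : CompleteSpace M := hMclosed.completeSpace_coe
  -- On M, the intersection of all ranges, s is onto: two preimages of y, in the ranges of s^K and
  -- of s^k, differ by a kernel vector in the range of s^K, which lies in the range of s^k. So one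
  -- preimage works for all k, and being a limit of units gives injectivity too.
  have hMunit : IsUnit (s.restrict hM) := by
    refine (h.restrict hM fun w hw x hx => ?_).isUnit_of_surjective ?_
    · rw [hMmem] at hx ⊢
      exact fun k => mem_range_pow_of_sub_smul_mem hw (hx k)
    · rintro ⟨y, hy⟩
      rw [hMmem] at hy
      have hpre : ∀ k : ℕ, ∃ x ∈ (s ^ k).range, s x = y := by
        intro k
        obtain ⟨z, hz⟩ := hy (k + 1)
        exact ⟨(s ^ k) z, ⟨z, rfl⟩, by rw [← hz, pow_succ']; rfl⟩
      obtain ⟨x, hx, hxy⟩ := hpre K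
      refine ⟨⟨x, ?_⟩, Subtype.ext hxy⟩
      rw [hMmem]
      intro k
      rcases le_total k K with hk | hk
      · exact hanti hk hx
      · obtain ⟨x', hx', hxy'⟩ := hpre k
        have h1 : x - x' ∈ (s ^ k).range :=
          hK k hk _ (by rw [map_sub, hxy, hxy', sub_self])
            (Submodule.sub_mem _ hx (hanti hk hx'))
        have := Submodule.add_mem _ h1 hx'
        rwa [sub_add_cancel] at this
  have hker : ∀ x, s x = 0 → x ∈ (s ^ K).range → x = 0 := by
    intro x hx hxK
    have hxM : x ∈ M := by
      rw [hMmem]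
      intro k
      rcases le_total k K with hk | hk
      · exact hanti hk hxK
      · exact hK k hk x hx hxK
    have hinj := (ContinuousLinearMap.isUnit_iff_bijective.mp hMunit).1
    have : (⟨x, hxM⟩ : M) = 0 := hinj (Subtype.ext (by simpa using hx))
    exact congrArg Subtype.val this
  have hZ : CompleteSpace (s ^ K).range := (hclosed K).completeSpace_coe
  refine IsDrazin.of_restrict_range_pow (n := K) (IsUnit.isDrazin ?_)
  refine (h.restrict (map_mem_range_pow s K) fun w hw x hx =>
    mem_range_pow_of_sub_smul_mem hw hx).isUnit_of_injective ?_ ?_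
  · rw [injective_iff_map_eq_zero]
    intro x hx
    exact Subtype.ext (hker x (congrArg Subtype.val hx) x.2)
  · have : Set.range (s.restrict (map_mem_range_pow s K)) =
        Subtype.val ⁻¹' ((s ^ (K + 1)).range : Set X) := by
      ext y
      constructor
      · rintro ⟨⟨_, ⟨z, rfl⟩⟩, rfl⟩
        exact ⟨z, by rw [pow_succ']; rfl⟩
      · rintro ⟨z, hz⟩
        refine ⟨⟨(s ^ K) z, ⟨z, rfl⟩⟩, Subtype.ext ?_⟩
        rw [← hz, pow_succ']
        rfl
    rw [this]
    exact (hclosed (K + 1)).preimage continuous_subtype_val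

theorem IsLimitOfUnits.isDrazin_of_isBFredholm {t : X →L[ℂ] X} (h : IsLimitOfUnits t)
    (ht : IsBFredholm t) : IsDrazin t := by
  obtain ⟨n, hcl, hfr⟩ := ht
  have : CompleteSpace (t ^ n).range := hcl.completeSpace_coe
  refine IsDrazin.of_restrict_range_pow (n := n) ?_
  exact (h.restrict (map_mem_range_pow t n) fun w hw x hx =>
    mem_range_pow_of_sub_smul_mem hw hx).isDrazin_of_isFredholm hfr

omit [CompleteSpace X] in
theorem isLimitOfUnits_of_frequently {T : X →L[ℂ] X} {l : ℂ}
    (h : ∃ᶠ z in 𝓝[≠] l, z ∉ spectrum ℂ T) :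
    IsLimitOfUnits (T - algebraMap ℂ (X →L[ℂ] X) l) := by
  intro ε hε
  have hball : ∀ᶠ z in 𝓝[≠] l, z ∈ Metric.ball l ε ∧ z ≠ l :=
    (Filter.Eventually.filter_mono inf_le_left (Metric.ball_mem_nhds l hε)).and
      self_mem_nhdsWithin
  obtain ⟨z, hz, hzb, hzl⟩ := (h.and_eventually hball).exists
  refine ⟨z - l, sub_ne_zero.mpr hzl, by simpa [dist_eq_norm] using hzb, ?_⟩
  rw [map_sub, sub_sub_sub_cancel_right, ← neg_sub, IsUnit.neg_iff]
  exact spectrum.notMem_iff.mp hz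

/-- The set of points where `T - l` is not Drazin invertible. -/
def drazinSpectrum (T : X →L[ℂ] X) : Set ℂ :=
  {l : ℂ | ¬ IsDrazin (T - algebraMap ℂ (X →L[ℂ] X) l)}

/-- A connectedness argument on the complement of the finite set. The set `u` of points with a
punctured neighbourhood in the resolvent set is open and contains all points near infinity. It is
also relatively closed: at a limit point the translate is B-Fredholm and a limit of units, hence
Drazin invertible, hence the point is in `u`. -/
theorem drazinSpectrum_subset_of_finite {T : X →L[ℂ] X} (h : (bFredholmSpectrum T).Finite) :
    drazinSpectrum T ⊆ bFredholmSpectrum T := by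
  have hconn : IsPreconnected (bFredholmSpectrum T)ᶜ :=
    (h.countable.isConnected_compl_of_one_lt_rank (by simp)).isPreconnected
  let u : Set ℂ := {l | ∀ᶠ z in 𝓝[≠] l, z ∉ spectrum ℂ T}
  have hρ : IsOpen (spectrum ℂ T)ᶜ := (spectrum.isClosed T).isOpen_compl
  have hρu : (spectrum ℂ T)ᶜ ⊆ u := fun l hl =>
    Filter.Eventually.filter_mono inf_le_left (hρ.mem_nhds hl)
  have hu : IsOpen u := by
    rw [isOpen_iff_mem_nhds]
    intro l hl
    have hl' : ∀ᶠ z in 𝓝[≠] l, z ∉ spectrum ℂ T := hl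
    have h1 : ∀ᶠ z in 𝓝[≠] l, z ∈ u := hl'.mono fun z hz => hρu hz
    rw [eventually_nhdsWithin_iff] at h1
    filter_upwards [h1] with z hz
    by_cases hzl : z = l
    · rw [hzl]; exact hl
    · exact hz hzl
  have hne : ((bFredholmSpectrum T)ᶜ ∩ u).Nonempty := by
    have h1 : ∀ᶠ z in Bornology.cobounded ℂ, z ∉ bFredholmSpectrum T := h.isBounded
    have h2 : ∀ᶠ z in Bornology.cobounded ℂ, z ∉ spectrum ℂ T := (spectrum.isCompact T).isBounded
    obtain ⟨z, hz1, hz2⟩ := (h1.and h2).exists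
    exact ⟨z, hz1, hρu hz2⟩
  have hsub : (bFredholmSpectrum T)ᶜ ⊆ {l | IsDrazin (T - algebraMap ℂ (X →L[ℂ] X) l)} := by
    have hlim : ∀ l, l ∈ closure u → l ∉ bFredholmSpectrum T →
        IsDrazin (T - algebraMap ℂ (X →L[ℂ] X) l) := by
      intro l hl hlB
      have hB : IsBFredholm (T - algebraMap ℂ (X →L[ℂ] X) l) := by
        rw [← smul_id_eq_algebraMap]; exact not_not.mp hlB
      refine (isLimitOfUnits_of_frequently ?_).isDrazin_of_isBFredholm hB
      rw [frequently_nhdsWithin_iff, frequently_iff]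
      intro V hV
      obtain ⟨W, hWV, hW, hlW⟩ := mem_nhds_iff.mp hV
      obtain ⟨z, hzW, hzu⟩ := mem_closure_iff.mp hl W hW hlW
      have h1 : ∀ᶠ y in 𝓝[≠] z, y ∉ spectrum ℂ T ∧ y ∈ W :=
        (show ∀ᶠ y in 𝓝[≠] z, y ∉ spectrum ℂ T from hzu).and (Filter.Eventually.filter_mono inf_le_left (hW.mem_nhds hzW))
      by_cases hzl : z = l
      · subst hzl
        obtain ⟨y, ⟨hy, hyW⟩, hyz⟩ := (h1.and self_mem_nhdsWithin).exists
        exact ⟨y, hWV hyW, hy, hyz⟩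
      · have h2 : ∀ᶠ y in 𝓝[≠] z, y ≠ l :=
          Filter.Eventually.filter_mono inf_le_left (isOpen_ne.mem_nhds hzl)
        obtain ⟨y, ⟨hy, hyW⟩, hyl⟩ := (h1.and h2).exists
        exact ⟨y, hWV hyW, hy, hyl⟩
    have := hconn.subset_of_closure_inter_subset hu hne fun l hl =>
      (hlim l hl.1 hl.2).exists_analyticAt.1
    exact fun l hl => hlim l (subset_closure (this hl)) hl
  intro l hl
  by_contra hlB
  exact hl (hsub hlB)

theorem finite_bFredholmSpectrum_iff {T : X →L[ℂ] X} :
    (bFredholmSpectrum T).Finite ↔ (drazinSpectrum T).Finite := by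
  refine ⟨fun h => h.subset (drazinSpectrum_subset_of_finite h), fun h => h.subset ?_⟩
  intro l hl hD
  refine hl ?_
  rw [smul_id_eq_algebraMap]
  exact hD.isBFredholm

end Fredholm

/-! ### Contour integrals, winding numbers and Cauchy transforms. -/

section ContourIntegral

variable {E : Type*} [NormedAddCommGroup E] [NormedSpace ℂ E] {γ : ℝ → ℂ}

theorem continuousOn_deriv_smul (hγ : ContDiff ℝ 1 γ) {g : ℂ → E}
    (hg : ContinuousOn (fun t => g (γ t)) (Set.Icc 0 1)) :
    ContinuousOn (fun t => deriv γ t • g (γ t)) (Set.Icc 0 1) :=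
  (hγ.continuous_deriv le_rfl).continuousOn.smul hg

theorem intervalIntegrable_deriv_smul (hγ : ContDiff ℝ 1 γ) {g : ℂ → E}
    (hg : ContinuousOn (fun t => g (γ t)) (Set.Icc 0 1)) :
    IntervalIntegrable (fun t => deriv γ t • g (γ t)) MeasureTheory.volume 0 1 :=
  ContinuousOn.intervalIntegrable_of_Icc zero_le_one (continuousOn_deriv_smul hγ hg)

theorem contourIntegral_congr {f g : ℂ → E} (h : ∀ t ∈ Set.Icc (0 : ℝ) 1, f (γ t) = g (γ t)) :
    contourIntegral γ f = contourIntegral γ g := by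
  refine intervalIntegral.integral_congr fun t ht => ?_
  rw [Set.uIcc_of_le zero_le_one] at ht
  simp only [h t ht]

theorem contourIntegral_add (hγ : ContDiff ℝ 1 γ) {f g : ℂ → E}
    (hf : ContinuousOn (fun t => f (γ t)) (Set.Icc 0 1))
    (hg : ContinuousOn (fun t => g (γ t)) (Set.Icc 0 1)) :
    contourIntegral γ (fun z => f z + g z) = contourIntegral γ f + contourIntegral γ g := by
  unfold contourIntegral
  rw [← intervalIntegral.integral_add (intervalIntegrable_deriv_smul hγ hf)
    (intervalIntegrable_deriv_smul hγ hg)]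
  simp only [smul_add]

theorem contourIntegral_sub (hγ : ContDiff ℝ 1 γ) {f g : ℂ → E}
    (hf : ContinuousOn (fun t => f (γ t)) (Set.Icc 0 1))
    (hg : ContinuousOn (fun t => g (γ t)) (Set.Icc 0 1)) :
    contourIntegral γ (fun z => f z - g z) = contourIntegral γ f - contourIntegral γ g := by
  unfold contourIntegral
  rw [← intervalIntegral.integral_sub (intervalIntegrable_deriv_smul hγ hf)
    (intervalIntegrable_deriv_smul hγ hg)]
  simp only [smul_sub]

theorem contourIntegral_smul_const [CompleteSpace E] (f : ℂ → ℂ) (c : E) :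
    contourIntegral γ (fun z => f z • c) = contourIntegral γ f • c := by
  unfold contourIntegral
  rw [← intervalIntegral.integral_smul_const]
  simp only [smul_smul, smul_eq_mul]

theorem contourIntegral_comp_clm [CompleteSpace E] {E' : Type*} [NormedAddCommGroup E']
    [NormedSpace ℂ E'] [CompleteSpace E'] (hγ : ContDiff ℝ 1 γ) (L : E →L[ℂ] E') {f : ℂ → E}
    (hf : ContinuousOn (fun t => f (γ t)) (Set.Icc 0 1)) :
    contourIntegral γ (fun z => L (f z)) = L (contourIntegral γ f) := by
  unfold contourIntegral
  rw [← L.intervalIntegral_comp_comm (intervalIntegrable_deriv_smul hγ hf)]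
  simp only [map_smul]

theorem contourIntegral_eq_zero_of_hasDerivAt [CompleteSpace E] (hγ : ContDiff ℝ 1 γ)
    (hclosed : γ 0 = γ 1) {F g : ℂ → E}
    (hF : ∀ t ∈ Set.Icc (0 : ℝ) 1, HasDerivAt F (g (γ t)) (γ t))
    (hg : ContinuousOn (fun t => g (γ t)) (Set.Icc 0 1)) : contourIntegral γ g = 0 := by
  unfold contourIntegral
  rw [intervalIntegral.integral_eq_sub_of_hasDerivAt (f := F ∘ γ) ?_
    (intervalIntegrable_deriv_smul hγ hg)]
  · simp [hclosed]
  · intro t ht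
    rw [Set.uIcc_of_le zero_le_one] at ht
    exact (hF t ht).scomp t ((hγ.differentiable one_ne_zero) t).hasDerivAt

theorem continuousOn_inv_sub (hγ : ContDiff ℝ 1 γ) {w : ℂ}
    (hw : ∀ t ∈ Set.Icc (0 : ℝ) 1, γ t ≠ w) :
    ContinuousOn (fun t => (γ t - w)⁻¹) (Set.Icc 0 1) :=
  (hγ.continuous.sub continuous_const).continuousOn.inv₀ fun t ht => sub_ne_zero.mpr (hw t ht)

/-- Along the curve the quotient (z - w)/(z - w₀) stays within distance 1 of 1, so its principal
logarithm is a primitive of the difference of the integrands. -/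
theorem contourIntegral_inv_sub_eq (hγ : ContDiff ℝ 1 γ) (hclosed : γ 0 = γ 1) {w w₀ : ℂ}
    (h : ∀ t ∈ Set.Icc (0 : ℝ) 1, ‖w - w₀‖ < ‖γ t - w₀‖) :
    contourIntegral γ (fun z => (z - w)⁻¹) = contourIntegral γ (fun z => (z - w₀)⁻¹) := by
  have h0 : ∀ t ∈ Set.Icc (0 : ℝ) 1, γ t ≠ w₀ := fun t ht he => by
    have := h t ht
    rw [he, sub_self, norm_zero] at this
    exact absurd this (not_lt.mpr (norm_nonneg _))
  have h1 : ∀ t ∈ Set.Icc (0 : ℝ) 1, γ t ≠ w := fun t ht he => by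
    have := h t ht
    rw [he] at this
    exact lt_irrefl _ this
  rw [← sub_eq_zero, ← contourIntegral_sub hγ (continuousOn_inv_sub hγ h1)
    (continuousOn_inv_sub hγ h0)]
  refine contourIntegral_eq_zero_of_hasDerivAt hγ hclosed
    (F := fun z => Complex.log ((z - w) / (z - w₀))) (fun t ht => ?_)
    ((continuousOn_inv_sub hγ h1).sub (continuousOn_inv_sub hγ h0))
  have e0 : γ t - w₀ ≠ 0 := sub_ne_zero.mpr (h0 t ht)
  have e1 : γ t - w ≠ 0 := sub_ne_zero.mpr (h1 t ht)
  have hslit : (γ t - w) / (γ t - w₀) ∈ Complex.slitPlane := by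
    have : (γ t - w) / (γ t - w₀) = 1 + -((w - w₀) / (γ t - w₀)) := by field_simp; ring
    rw [this]
    apply Complex.mem_slitPlane_of_norm_lt_one
    rw [norm_neg, norm_div, div_lt_one (norm_pos_iff.mpr e0)]
    exact h t ht
  have hd := (((hasDerivAt_id (γ t)).sub_const w).div ((hasDerivAt_id (γ t)).sub_const w₀)
    e0).clog hslit
  refine hd.congr_deriv ?_
  simp only [id, Pi.div_apply]
  field_simp

theorem contourIntegral_inv_sub_eq_zero (hγ : ContDiff ℝ 1 γ) (hclosed : γ 0 = γ 1) {w c : ℂ}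
    (h : ∀ t ∈ Set.Icc (0 : ℝ) 1, ‖γ t - c‖ < ‖w - c‖) :
    contourIntegral γ (fun z => (z - w)⁻¹) = 0 := by
  have h1 : ∀ t ∈ Set.Icc (0 : ℝ) 1, γ t ≠ w := fun t ht he => by
    have := h t ht
    rw [he] at this
    exact lt_irrefl _ this
  refine contourIntegral_eq_zero_of_hasDerivAt hγ hclosed
    (F := fun z => Complex.log ((z - w) / (c - w))) (fun t ht => ?_) (continuousOn_inv_sub hγ h1)
  have e0 : c - w ≠ 0 := by
    have := (norm_nonneg _).trans_lt (h t ht)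
    rw [norm_sub_rev] at this
    exact norm_pos_iff.mp this
  have e1 : γ t - w ≠ 0 := sub_ne_zero.mpr (h1 t ht)
  have hslit : (γ t - w) / (c - w) ∈ Complex.slitPlane := by
    have : (γ t - w) / (c - w) = 1 + (γ t - c) / (c - w) := by field_simp; ring
    rw [this]
    apply Complex.mem_slitPlane_of_norm_lt_one
    rw [norm_div, div_lt_one (norm_pos_iff.mpr e0), norm_sub_rev c]
    exact h t ht
  have hd := (((hasDerivAt_id (γ t)).sub_const w).div_const (c - w)).clog hslit
  refine hd.congr_deriv ?_
  simp only [id]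
  field_simp

/-- Only a bound on G is needed: Cauchy's estimate on discs of radius r/4 about points of the half
ball turns it into a uniform Lipschitz constant. The derivative is measurable as a limit of
difference quotients. -/
theorem differentiableAt_integral_of_norm_le [CompleteSpace E] {G : ℝ → ℂ → E} {w₀ : ℂ} {r C : ℝ}
    (hr : 0 < r) (hcont : ∀ w ∈ Metric.ball w₀ r, ContinuousOn (fun t => G t w) (Set.Icc 0 1))
    (hdiff : ∀ t ∈ Set.Icc (0 : ℝ) 1, DifferentiableOn ℂ (G t) (Metric.ball w₀ r))
    (hC : ∀ t ∈ Set.Icc (0 : ℝ) 1, ∀ w ∈ Metric.ball w₀ r, ‖G t w‖ ≤ C) :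
    DifferentiableAt ℂ (fun w => ∫ t in (0 : ℝ)..1, G t w) w₀ := by
  have hIoc : Set.uIoc (0 : ℝ) 1 ⊆ Set.Icc 0 1 := by
    rw [Set.uIoc_of_le zero_le_one]; exact Set.Ioc_subset_Icc_self
  have hmeas : ∀ w ∈ Metric.ball w₀ r, MeasureTheory.AEStronglyMeasurable (fun t => G t w)
      (MeasureTheory.volume.restrict (Set.uIoc 0 1)) := fun w hw =>
    ((hcont w hw).mono hIoc).aestronglyMeasurable measurableSet_uIoc
  have hw₀ : w₀ ∈ Metric.ball w₀ r := Metric.mem_ball_self hr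
  have hderiv : ∀ t ∈ Set.Icc (0 : ℝ) 1, HasDerivAt (G t) (deriv (G t) w₀) w₀ := fun t ht =>
    ((hdiff t ht).differentiableAt (Metric.isOpen_ball.mem_nhds hw₀)).hasDerivAt
  have hmeas' : MeasureTheory.AEStronglyMeasurable (fun t => deriv (G t) w₀)
      (MeasureTheory.volume.restrict (Set.uIoc 0 1)) := by
    obtain ⟨v, hv0, hv⟩ : ∃ v : ℕ → ℂ, (∀ n, v n ∈ Metric.ball w₀ r) ∧
        Tendsto v atTop (𝓝[≠] w₀) := by
      have hne : (𝓝[≠] w₀ ⊓ 𝓟 (Metric.ball w₀ r)).NeBot := by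
        rw [inf_eq_left.mpr]
        · infer_instance
        · exact le_principal_iff.mpr (mem_nhdsWithin_of_mem_nhds (Metric.isOpen_ball.mem_nhds hw₀))
      obtain ⟨v, hv⟩ := exists_seq_tendsto (𝓝[≠] w₀)
      have hb : ∀ᶠ n in atTop, v n ∈ Metric.ball w₀ r := hv.eventually
        (mem_nhdsWithin_of_mem_nhds (Metric.isOpen_ball.mem_nhds hw₀))
      obtain ⟨N, hN⟩ := eventually_atTop.mp hb
      exact ⟨fun n => v (n + N), fun n => hN _ (Nat.le_add_left _ _),
        hv.comp (tendsto_add_atTop_nat N)⟩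
    refine aestronglyMeasurable_of_tendsto_ae atTop
      (f := fun n t => (v n - w₀)⁻¹ • (G t (v n) - G t w₀)) (fun n => ?_) ?_
    · exact ((hmeas _ (hv0 n)).sub (hmeas _ hw₀)).const_smul _
    · refine (MeasureTheory.ae_restrict_iff' measurableSet_uIoc).mpr (Eventually.of_forall ?_)
      intro t ht
      exact (hasDerivAt_iff_tendsto_slope.mp (hderiv t (hIoc ht))).comp hv
  have hball : ∀ w ∈ Metric.ball w₀ (r / 2), Metric.closedBall w (r / 4) ⊆ Metric.ball w₀ r := by
    intro w hw
    refine (Metric.closedBall_subset_ball' ?_)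
    rw [Metric.mem_ball] at hw
    linarith
  refine (intervalIntegral.hasDerivAt_integral_of_dominated_loc_of_lip (F := fun w t => G t w)
    (F' := fun t => deriv (G t) w₀) (bound := fun _ => C / (r / 4))
    (Metric.ball_mem_nhds w₀ (half_pos hr)) ?_ ?_ hmeas' ?_ ?_ ?_).2.differentiableAt
  · filter_upwards [Metric.ball_mem_nhds w₀ hr] with w hw
    exact hmeas w hw
  · exact ContinuousOn.intervalIntegrable_of_Icc zero_le_one (hcont w₀ hw₀)
  · refine Eventually.of_forall fun t ht => ?_
    refine Convex.lipschitzOnWith_of_nnnorm_deriv_le (𝕜 := ℂ) (fun w hw => ?_) (fun w hw => ?_)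
      (convex_ball w₀ (r / 2))
    · exact (hdiff t (hIoc ht)).differentiableAt (Metric.isOpen_ball.mem_nhds
        (Metric.ball_subset_ball (by linarith) hw))
    · rw [← NNReal.coe_le_coe, Real.coe_nnabs, coe_nnnorm]
      refine le_trans ?_ (le_abs_self _)
      refine Complex.norm_deriv_le_of_forall_mem_sphere_norm_le (by positivity) ?_ ?_
      · refine DifferentiableOn.diffContOnCl_ball ?_ (hball w hw)
        exact hdiff t (hIoc ht)
      · intro z hz
        exact hC t (hIoc ht) z (hball w hw (Metric.sphere_subset_closedBall hz))
  · exact intervalIntegrable_const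
  · exact Eventually.of_forall fun t ht => hderiv t (hIoc ht)

theorem exists_ball_forall_dist_le (hγ : Continuous γ) {w₀ : ℂ}
    (hw : ∀ t ∈ Set.Icc (0 : ℝ) 1, γ t ≠ w₀) :
    ∃ r > 0, ∀ t ∈ Set.Icc (0 : ℝ) 1, r ≤ ‖γ t - w₀‖ := by
  obtain ⟨t, ht, hmin⟩ := isCompact_Icc.exists_isMinOn (s := Set.Icc (0 : ℝ) 1)
    (Set.nonempty_Icc.mpr zero_le_one) (hγ.sub continuous_const).norm.continuousOn
  exact ⟨‖γ t - w₀‖, norm_pos_iff.mpr (sub_ne_zero.mpr (hw t ht)), fun s hs => hmin hs⟩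

omit [NormedSpace ℂ E] in
theorem exists_norm_le_of_continuousOn_Icc {f : ℝ → E} (hf : ContinuousOn f (Set.Icc 0 1)) :
    ∃ C > 0, ∀ t ∈ Set.Icc (0 : ℝ) 1, ‖f t‖ ≤ C := by
  obtain ⟨C, hC⟩ := isCompact_Icc.exists_bound_of_continuousOn hf
  exact ⟨max C 1, by positivity, fun t ht => (hC t ht).trans (le_max_left _ _)⟩

/-- The Cauchy transform along `γ` is holomorphic off `γ`. -/
theorem differentiableAt_cauchyTransform [CompleteSpace E] (hγ : ContDiff ℝ 1 γ) {g : ℂ → E}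
    (hg : ContinuousOn (fun t => g (γ t)) (Set.Icc 0 1)) {w₀ : ℂ}
    (hw : ∀ t ∈ Set.Icc (0 : ℝ) 1, γ t ≠ w₀) :
    DifferentiableAt ℂ (fun w => contourIntegral γ fun z => (z - w)⁻¹ • g z) w₀ := by
  obtain ⟨r, hr, hrt⟩ := exists_ball_forall_dist_le hγ.continuous hw
  obtain ⟨C, hC0, hC⟩ := exists_norm_le_of_continuousOn_Icc (continuousOn_deriv_smul hγ hg)
  have hdist : ∀ t ∈ Set.Icc (0 : ℝ) 1, ∀ w ∈ Metric.ball w₀ (r / 2), r / 2 ≤ ‖γ t - w‖ := by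
    intro t ht w hw
    rw [mem_ball_iff_norm] at hw
    have h1 := hrt t ht
    have h2 := norm_add_le (γ t - w) (w - w₀)
    rw [sub_add_sub_cancel] at h2
    linarith
  have hne : ∀ t ∈ Set.Icc (0 : ℝ) 1, ∀ w ∈ Metric.ball w₀ (r / 2), γ t ≠ w := by
    intro t ht w hw he
    have := hdist t ht w hw
    rw [he, sub_self, norm_zero] at this
    linarith
  refine differentiableAt_integral_of_norm_le (r := r / 2) (C := (r / 2)⁻¹ * C) (by positivity)
    (G := fun t w => deriv γ t • ((γ t - w)⁻¹ • g (γ t))) ?_ ?_ ?_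
  · intro w hw
    exact continuousOn_deriv_smul (g := fun z => (z - w)⁻¹ • g z) hγ
      ((continuousOn_inv_sub hγ fun t ht => hne t ht w hw).smul hg)
  · intro t ht w hw
    refine DifferentiableAt.differentiableWithinAt ?_
    refine DifferentiableAt.const_smul (DifferentiableAt.smul_const ?_ _) _
    exact ((differentiableAt_const _).sub differentiableAt_id).inv
      (sub_ne_zero.mpr (hne t ht w hw))
  · intro t ht w hw
    rw [smul_comm, norm_smul, norm_inv]
    gcongr
    · exact hdist t ht w hw
    · exact hC t ht

theorem tendsto_cauchyTransform_cobounded (hγ : ContDiff ℝ 1 γ) {g : ℂ → E}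
    (hg : ContinuousOn (fun t => g (γ t)) (Set.Icc 0 1)) :
    Tendsto (fun w => contourIntegral γ fun z => (z - w)⁻¹ • g z) (Bornology.cobounded ℂ)
      (𝓝 0) := by
  obtain ⟨C, hC0, hC⟩ := exists_norm_le_of_continuousOn_Icc (continuousOn_deriv_smul hγ hg)
  obtain ⟨ρ, hρ0, hρ⟩ := exists_norm_le_of_continuousOn_Icc (f := γ) hγ.continuous.continuousOn
  have hlim : Tendsto (fun w : ℂ => C / (‖w‖ - ρ)) (Bornology.cobounded ℂ) (𝓝 0) :=
    tendsto_const_nhds.div_atTop (tendsto_atTop_add_const_right _ (-ρ) tendsto_norm_cobounded_atTop)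
  refine squeeze_zero_norm' ?_ hlim
  filter_upwards [tendsto_norm_cobounded_atTop.eventually_gt_atTop ρ] with w hw
  have := intervalIntegral.norm_integral_le_of_norm_le_const (a := (0 : ℝ)) (b := 1)
    (f := fun t => deriv γ t • ((γ t - w)⁻¹ • g (γ t))) (C := C / (‖w‖ - ρ)) ?_
  · simpa [contourIntegral] using this
  · intro t ht
    rw [Set.uIoc_of_le zero_le_one] at ht
    have ht' := Set.Ioc_subset_Icc_self ht
    rw [smul_comm, norm_smul, norm_inv, div_eq_inv_mul]
    have h1 : ‖w‖ - ρ ≤ ‖γ t - w‖ := by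
      have h2 := norm_sub_norm_le w (γ t)
      rw [norm_sub_rev] at h2
      linarith [hρ t ht']
    have h3 : 0 < ‖w‖ - ρ := sub_pos.mpr hw
    gcongr
    exact hC t ht'

end ContourIntegral

/-! ### Cauchy's theorem for cycles, by Dixon's method. -/

section Cauchy

theorem dslope_comm (f : ℂ → ℂ) (a b : ℂ) : dslope f a b = dslope f b a := by
  by_cases h : b = a
  · rw [h]
  · rw [dslope_of_ne f h, dslope_of_ne f (Ne.symm h), slope_comm]

theorem differentiableOn_dslope_left {f : ℂ → ℂ} {U : Set ℂ} (hU : IsOpen U)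
    (hf : DifferentiableOn ℂ f U) {z : ℂ} (hz : z ∈ U) :
    DifferentiableOn ℂ (fun w => dslope f w z) U := by
  have : (fun w => dslope f w z) = dslope f z := funext fun w => dslope_comm f w z
  rw [this]
  exact (Complex.differentiableOn_dslope (hU.mem_nhds hz)).mpr hf

/-- Divided differences of `f` are bounded for one variable near `w₀` and the other in a compact
set. -/
theorem exists_norm_dslope_le {f : ℂ → ℂ} {U K : Set ℂ} (hU : IsOpen U)
    (hf : DifferentiableOn ℂ f U) (hK : IsCompact K) (hKU : K ⊆ U) {w₀ : ℂ} (hw₀ : w₀ ∈ U) :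
    ∃ r > 0, ∃ C, Metric.ball w₀ r ⊆ U ∧
      ∀ z ∈ K, ∀ w ∈ Metric.ball w₀ r, ‖dslope f w z‖ ≤ C := by
  obtain ⟨R, hR, hRU⟩ := Metric.nhds_basis_closedBall.mem_iff.mp (hU.mem_nhds hw₀)
  have hcomp := isCompact_closedBall w₀ R
  obtain ⟨C₁, hC₁⟩ := hcomp.exists_bound_of_continuousOn (f := deriv f)
    (((hf.deriv hU).continuousOn).mono hRU)
  obtain ⟨C₂, hC₂⟩ := hcomp.exists_bound_of_continuousOn (hf.continuousOn.mono hRU)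
  obtain ⟨C₃, hC₃⟩ := hK.exists_bound_of_continuousOn (hf.continuousOn.mono hKU)
  have hsub : Metric.ball w₀ (R / 2) ⊆ Metric.closedBall w₀ R :=
    (Metric.ball_subset_ball (by linarith)).trans Metric.ball_subset_closedBall
  refine ⟨R / 2, by positivity, max C₁ ((C₃ + C₂) / (R / 2)), hsub.trans hRU, ?_⟩
  intro z hz w hw
  by_cases hzw : z = w
  · rw [hzw, dslope_same]
    exact (hC₁ w (hsub hw)).trans (le_max_left _ _)
  rw [dslope_of_ne f hzw, slope_def_field, norm_div]
  have hpos : 0 < ‖z - w‖ := norm_pos_iff.mpr (sub_ne_zero.mpr hzw)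
  -- For z near w₀ the bound is the mean value inequality. Otherwise |z - w| ≥ R/2 and the numerator
  -- is bounded crudely.
  by_cases hzR : z ∈ Metric.closedBall w₀ R
  · refine le_trans ?_ (le_max_left _ _)
    rw [div_le_iff₀ hpos]
    exact (convex_closedBall w₀ R).norm_image_sub_le_of_norm_deriv_le
      (fun x hx => hf.differentiableAt (hU.mem_nhds (hRU hx))) hC₁ (hsub hw) hzR
  · refine le_trans ?_ (le_max_right _ _)
    have h1 : R / 2 ≤ ‖z - w‖ := by
      rw [Metric.mem_closedBall, dist_eq_norm, not_le] at hzR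
      rw [mem_ball_iff_norm] at hw
      have := norm_add_le (z - w) (w - w₀)
      rw [sub_add_sub_cancel] at this
      linarith
    have h2 : ‖f z - f w‖ ≤ C₃ + C₂ := (norm_sub_le _ _).trans (add_le_add (hC₃ z hz) (hC₂ w (hsub hw)))
    have h3 : 0 ≤ C₃ + C₂ := (norm_nonneg _).trans h2
    gcongr

variable {m : ℕ} {Γ : Fin m → ℝ → ℂ}

/-- Off the curves, the total winding number is locally constant. -/
theorem exists_ball_sum_contourIntegral_eq (hΓ : ∀ j, ContDiff ℝ 1 (Γ j))
    (hclosed : ∀ j, Γ j 0 = Γ j 1) {w₀ : ℂ}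
    (hw₀ : ∀ j, ∀ t ∈ Set.Icc (0 : ℝ) 1, Γ j t ≠ w₀) :
    ∃ r > 0, ∀ w ∈ Metric.ball w₀ r, (∀ j, ∀ t ∈ Set.Icc (0 : ℝ) 1, Γ j t ≠ w) ∧
      ∀ j, contourIntegral (Γ j) (fun z => (z - w)⁻¹) =
        contourIntegral (Γ j) (fun z => (z - w₀)⁻¹) := by
  choose r hr hrt using fun j => exists_ball_forall_dist_le (hΓ j).continuous (hw₀ j)
  obtain ⟨ρ, hρ, hρr⟩ : ∃ ρ > 0, ∀ j, ρ ≤ r j := by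
    rcases Nat.eq_zero_or_pos m with rfl | hm
    · exact ⟨1, one_pos, fun j => j.elim0⟩
    · have : Nonempty (Fin m) := ⟨⟨0, hm⟩⟩
      obtain ⟨j, hj⟩ := Finite.exists_min r
      exact ⟨r j, hr j, hj⟩
  refine ⟨ρ, hρ, fun w hw => ?_⟩
  rw [mem_ball_iff_norm] at hw
  have hlt : ∀ j, ∀ t ∈ Set.Icc (0 : ℝ) 1, ‖w - w₀‖ < ‖Γ j t - w₀‖ := fun j t ht =>
    hw.trans_le ((hρr j).trans (hrt j t ht))
  refine ⟨fun j t ht he => ?_, fun j => contourIntegral_inv_sub_eq (hΓ j) (hclosed j) (hlt j)⟩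
  have := hlt j t ht
  rw [he] at this
  exact lt_irrefl _ this

/-- Dixon's argument: integrating the divided difference of f gives a holomorphic function of w on
U. Where the winding number vanishes it agrees with the Cauchy transform of f, which extends it to
an entire function tending to 0 at infinity. By Liouville it is identically zero. -/
theorem sum_contourIntegral_eq_zero_of_winding {U : Set ℂ} (hU : IsOpen U)
    (hΓ : ∀ j, ContDiff ℝ 1 (Γ j)) (hclosed : ∀ j, Γ j 0 = Γ j 1)
    (hmem : ∀ j, ∀ t ∈ Set.Icc (0 : ℝ) 1, Γ j t ∈ U)
    (hwind : ∀ w ∉ U, ∑ j, contourIntegral (Γ j) (fun z => (z - w)⁻¹) = 0) {g : ℂ → ℂ}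
    (hg : DifferentiableOn ℂ g U) : ∑ j, contourIntegral (Γ j) g = 0 := by
  classical
  have hcont : ∀ {f : ℂ → ℂ}, ContinuousOn f U → ∀ j,
      ContinuousOn (fun t => f (Γ j t)) (Set.Icc 0 1) := fun hf j =>
    hf.comp (hΓ j).continuous.continuousOn (hmem j)
  have hds : ∀ {f : ℂ → ℂ}, DifferentiableOn ℂ f U → ∀ w ∈ U, ContinuousOn (dslope f w) U :=
    fun hf w hw => ((Complex.differentiableOn_dslope (hU.mem_nhds hw)).mpr hf).continuousOn
  have main : ∀ {f : ℂ → ℂ}, DifferentiableOn ℂ f U → ∀ w ∈ U,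
      ∑ j, contourIntegral (Γ j) (dslope f w) = 0 := by
    intro f hf
    let y : ℂ → ℂ := fun w => ∑ j, contourIntegral (Γ j) (fun z => (z - w)⁻¹ • f z)
    let h : ℂ → ℂ := fun w => if w ∈ U then ∑ j, contourIntegral (Γ j) (dslope f w) else y w
    have hy : ∀ w, (∀ j, ∀ t ∈ Set.Icc (0 : ℝ) 1, Γ j t ≠ w) →
        ∑ j, contourIntegral (Γ j) (fun z => (z - w)⁻¹) = 0 → h w = y w := by
      intro w hw hw0
      by_cases hwU : w ∈ U
      · have h1 : h w = ∑ j, contourIntegral (Γ j) (dslope f w) := if_pos hwU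
        have h2 : ∀ j, contourIntegral (Γ j) (dslope f w) =
            contourIntegral (Γ j) (fun z => (z - w)⁻¹ • f z) -
              contourIntegral (Γ j) (fun z => (z - w)⁻¹) • f w := by
          intro j
          rw [← contourIntegral_smul_const, ← contourIntegral_sub (hΓ j)]
          · refine contourIntegral_congr fun t ht => ?_
            rw [dslope_of_ne f (hw j t ht), slope_def_module, smul_sub]
          · exact (continuousOn_inv_sub (hΓ j) (hw j)).smul (hcont hf.continuousOn j)
          · exact (continuousOn_inv_sub (hΓ j) (hw j)).smul continuousOn_const
        rw [h1, Finset.sum_congr rfl fun j _ => h2 j, Finset.sum_sub_distrib, ← Finset.sum_smul,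
          hw0, zero_smul, sub_zero]
      · exact if_neg hwU
    have hdiff : Differentiable ℂ h := by
      intro w₀
      by_cases hw₀ : w₀ ∈ U
      · have heq : h =ᶠ[𝓝 w₀] fun w => ∑ j, contourIntegral (Γ j) (dslope f w) := by
          filter_upwards [hU.mem_nhds hw₀] with w hw
          exact if_pos hw
        refine DifferentiableAt.congr_of_eventuallyEq ?_ heq
        refine DifferentiableAt.fun_sum fun j _ => ?_
        obtain ⟨r, hr, C, hrU, hC⟩ := exists_norm_dslope_le hU hf
          (isCompact_Icc.image (hΓ j).continuous) (Set.image_subset_iff.mpr (hmem j)) hw₀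
        obtain ⟨D, hD0, hD⟩ := exists_norm_le_of_continuousOn_Icc (f := deriv (Γ j))
          ((hΓ j).continuous_deriv le_rfl).continuousOn
        refine differentiableAt_integral_of_norm_le (r := r) (C := D * C) hr
          (G := fun t w => deriv (Γ j) t • dslope f w (Γ j t)) ?_ ?_ ?_
        · intro w hw
          exact continuousOn_deriv_smul (hΓ j) (hcont (hds hf w (hrU hw)) j)
        · intro t ht
          exact ((differentiableOn_dslope_left hU hf (hmem j t ht)).mono hrU).const_smul
            (deriv (Γ j) t)
        · intro t ht w hw
          rw [norm_smul]
          exact mul_le_mul (hD t ht) (hC _ ⟨t, ht, rfl⟩ w hw) (norm_nonneg _) hD0.le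
      · have hne : ∀ j, ∀ t ∈ Set.Icc (0 : ℝ) 1, Γ j t ≠ w₀ := fun j t ht he =>
          hw₀ (he ▸ hmem j t ht)
        obtain ⟨r, hr, hball⟩ := exists_ball_sum_contourIntegral_eq hΓ hclosed hne
        have heq : h =ᶠ[𝓝 w₀] y := by
          filter_upwards [Metric.ball_mem_nhds w₀ hr] with w hw
          refine hy w (hball w hw).1 ?_
          rw [Finset.sum_congr rfl fun j _ => (hball w hw).2 j, hwind w₀ hw₀]
        refine DifferentiableAt.congr_of_eventuallyEq ?_ heq
        exact DifferentiableAt.fun_sum fun j _ =>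
          differentiableAt_cauchyTransform (hΓ j) (hcont hf.continuousOn j) (hne j)
    have hlim : Tendsto h (Bornology.cobounded ℂ) (𝓝 0) := by
      have hylim : Tendsto y (Bornology.cobounded ℂ) (𝓝 0) := by
        have := tendsto_finsetSum Finset.univ fun j _ =>
          tendsto_cauchyTransform_cobounded (hΓ j) (hcont hf.continuousOn j)
        simpa [y] using this
      refine hylim.congr' ?_
      have hfar : ∀ j, ∀ᶠ w in Bornology.cobounded ℂ, ∀ t ∈ Set.Icc (0 : ℝ) 1, ‖Γ j t‖ < ‖w‖ := by
        intro j
        obtain ⟨ρ, -, hρ⟩ := exists_norm_le_of_continuousOn_Icc (f := Γ j)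
          (hΓ j).continuous.continuousOn
        filter_upwards [tendsto_norm_cobounded_atTop.eventually_gt_atTop ρ] with w hw t ht
        exact (hρ t ht).trans_lt hw
      filter_upwards [eventually_all.mpr hfar] with w hw
      refine (hy w (fun j t ht he => ?_) (Finset.sum_eq_zero fun j _ => ?_)).symm
      · have := hw j t ht
        rw [he] at this
        exact lt_irrefl _ this
      · exact contourIntegral_inv_sub_eq_zero (hΓ j) (hclosed j) (c := 0)
          (by simpa using hw j)
    intro w hw
    have h0 := hdiff.apply_eq_of_tendsto_cocompact w (c := 0)
      (by rwa [← Metric.cobounded_eq_cocompact])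
    rwa [show h w = ∑ j, contourIntegral (Γ j) (dslope f w) from if_pos hw] at h0
  rcases Nat.eq_zero_or_pos m with rfl | hm
  · simp
  · set w := Γ ⟨0, hm⟩ 0 with hw
    have hwU : w ∈ U := hmem _ 0 (by simp)
    -- The divided difference at w of (z - w) g(z) is g. Any w in U serves, here a point of the
    -- first curve.
    have h1 := main (f := fun z => (z - w) * g z) ((differentiableOn_id.sub_const w).mul hg) w hwU
    rw [← h1]
    refine Finset.sum_congr rfl fun j _ => contourIntegral_congr fun t ht => ?_
    by_cases hz : Γ j t = w
    · rw [hz, dslope_same]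
      have h2 := ((hasDerivAt_id w).sub_const w).mul
        (hg.differentiableAt (hU.mem_nhds hwU)).hasDerivAt
      have h3 : deriv (fun z => (z - w) * g z) w = 1 * g w + (id w - w) * deriv g w := h2.deriv
      rw [h3]
      simp
    · rw [dslope_of_ne _ hz, slope_def_field]
      have : Γ j t - w ≠ 0 := sub_ne_zero.mpr hz
      field_simp
      simp

end Cauchy

/-! ### The holomorphic functional calculus. -/

section Calculus

variable {A : Type*} [NormedRing A] [NormedAlgebra ℂ A]

/-- `(2πi)⁻¹ ∑ ∫_Γ g(z) (z - a)⁻¹ dz`. -/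
def resolventIntegral {m : ℕ} (Γ : Fin m → ℝ → ℂ) (a : A) (g : ℂ → ℂ) : A :=
  (2 * Real.pi * Complex.I : ℂ)⁻¹ • ∑ j, contourIntegral (Γ j) (fun z => g z • resolvent a z)

variable [CompleteSpace A]

theorem continuousAt_resolvent {a : A} {z : ℂ} (hz : z ∉ spectrum ℂ a) :
    ContinuousAt (resolvent a) z :=
  (spectrum.hasDerivAt_resolvent_const_left (not_not.mp hz)).continuousAt

/-- If `w ↦ (a - w)⁻¹ c` extends holomorphically over the spectrum of `a`, then `c = 0`. -/
theorem eq_zero_of_sub_mul_eq {a c : A} {V : Set ℂ} (hV : IsOpen V) (hσ : spectrum ℂ a ⊆ V)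
    {y : ℂ → A} (hy : DifferentiableOn ℂ y V)
    (h : ∀ w ∈ V, (a - algebraMap ℂ A w) * y w = c) : c = 0 := by
  classical
  -- The two formulas agree off the spectrum, so Q is entire. It vanishes at infinity like the
  -- resolvent, so Liouville gives Q = 0.
  let Q : ℂ → A := fun w => if w ∈ V then y w else -(resolvent a w * c)
  have hQ : ∀ w ∉ spectrum ℂ a, Q w = -(resolvent a w * c) := by
    intro w hw
    by_cases hwV : w ∈ V
    · rw [show Q w = y w from if_pos hwV, ← h w hwV, ← neg_sub, neg_mul, mul_neg, neg_neg,
        ← mul_assoc, resolvent_mul_sub hw, one_mul]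
    · exact if_neg hwV
  have hdiff : Differentiable ℂ Q := by
    intro w
    by_cases hw : w ∈ V
    · refine (hy.differentiableAt (hV.mem_nhds hw)).congr_of_eventuallyEq ?_
      filter_upwards [hV.mem_nhds hw] with z hz
      exact if_pos hz
    · have hwσ : w ∉ spectrum ℂ a := fun h => hw (hσ h)
      have hR : DifferentiableAt ℂ (fun z => -(resolvent a z * c)) w :=
        ((spectrum.hasDerivAt_resolvent_const_left (not_not.mp hwσ)).differentiableAt.mul_const
          c).neg
      refine hR.congr_of_eventuallyEq ?_
      filter_upwards [(spectrum.isClosed a).isOpen_compl.mem_nhds hwσ] with z hz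
      exact hQ z hz
  have hlim : Tendsto Q (Bornology.cobounded ℂ) (𝓝 0) := by
    have h1 : Tendsto (fun z => -(resolvent a z * c)) (Bornology.cobounded ℂ) (𝓝 0) := by
      have := ((spectrum.resolvent_tendsto_cobounded (𝕜 := ℂ) a).mul_const c).neg
      rwa [zero_mul, neg_zero] at this
    refine h1.congr' ?_
    have h2 : ∀ᶠ z in Bornology.cobounded ℂ, z ∉ spectrum ℂ a := (spectrum.isBounded a)
    filter_upwards [h2] with z hz
    exact (hQ z hz).symm
  have h0 : ∀ w, Q w = 0 := fun w => hdiff.apply_eq_of_tendsto_cocompact w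
    (by rwa [← Metric.cobounded_eq_cocompact])
  by_cases hV0 : (0 : ℂ) ∈ V
  · rw [← h 0 hV0, ← show Q 0 = y 0 from if_pos hV0, h0, mul_zero]
  · have hσ0 : (0 : ℂ) ∉ spectrum ℂ a := fun h => hV0 (hσ h)
    have h1 := hQ 0 hσ0
    rw [h0, eq_comm, neg_eq_zero] at h1
    rw [← one_mul c, ← sub_mul_resolvent hσ0, mul_assoc, h1, mul_zero]

variable {m : ℕ} {Γ : Fin m → ℝ → ℂ} {a : A}

theorem continuousOn_smul_resolvent (hΓ : ∀ j, ContDiff ℝ 1 (Γ j))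
    (hσ : ∀ j, ∀ t ∈ Set.Icc (0 : ℝ) 1, Γ j t ∉ spectrum ℂ a) {g : ℂ → ℂ} {j : Fin m}
    (hg : ContinuousOn (fun t => g (Γ j t)) (Set.Icc 0 1)) :
    ContinuousOn (fun t => g (Γ j t) • resolvent a (Γ j t)) (Set.Icc 0 1) :=
  hg.smul fun t ht => ((continuousAt_resolvent (hσ j t ht)).comp
    (hΓ j).continuous.continuousAt).continuousWithinAt

theorem mul_resolventIntegral (hΓ : ∀ j, ContDiff ℝ 1 (Γ j))
    (hσ : ∀ j, ∀ t ∈ Set.Icc (0 : ℝ) 1, Γ j t ∉ spectrum ℂ a) {g : ℂ → ℂ}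
    (hg : ∀ j, ContinuousOn (fun t => g (Γ j t)) (Set.Icc 0 1)) (s : A) :
    s * resolventIntegral Γ a g = (2 * Real.pi * Complex.I : ℂ)⁻¹ •
      ∑ j, contourIntegral (Γ j) (fun z => s * (g z • resolvent a z)) := by
  unfold resolventIntegral
  rw [mul_smul_comm, Finset.mul_sum]
  congr 1
  refine Finset.sum_congr rfl fun j _ => ?_
  exact (contourIntegral_comp_clm (hΓ j) (ContinuousLinearMap.mul ℂ A s)
    (continuousOn_smul_resolvent hΓ hσ (hg j))).symm

theorem resolventIntegral_mul (hΓ : ∀ j, ContDiff ℝ 1 (Γ j))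
    (hσ : ∀ j, ∀ t ∈ Set.Icc (0 : ℝ) 1, Γ j t ∉ spectrum ℂ a) {g : ℂ → ℂ}
    (hg : ∀ j, ContinuousOn (fun t => g (Γ j t)) (Set.Icc 0 1)) (s : A) :
    resolventIntegral Γ a g * s = (2 * Real.pi * Complex.I : ℂ)⁻¹ •
      ∑ j, contourIntegral (Γ j) (fun z => (g z • resolvent a z) * s) := by
  unfold resolventIntegral
  rw [smul_mul_assoc, Finset.sum_mul]
  congr 1
  refine Finset.sum_congr rfl fun j _ => ?_
  exact (contourIntegral_comp_clm (hΓ j) ((ContinuousLinearMap.mul ℂ A).flip s)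
    (continuousOn_smul_resolvent hΓ hσ (hg j))).symm

theorem commute_resolventIntegral (hΓ : ∀ j, ContDiff ℝ 1 (Γ j))
    (hσ : ∀ j, ∀ t ∈ Set.Icc (0 : ℝ) 1, Γ j t ∉ spectrum ℂ a) {g : ℂ → ℂ}
    (hg : ∀ j, ContinuousOn (fun t => g (Γ j t)) (Set.Icc 0 1)) {s : A} (hs : Commute s a) :
    Commute s (resolventIntegral Γ a g) := by
  rw [Commute, SemiconjBy, mul_resolventIntegral hΓ hσ hg, resolventIntegral_mul hΓ hσ hg]
  congr 1
  refine Finset.sum_congr rfl fun j _ => contourIntegral_congr fun t _ => ?_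
  exact ((commute_resolvent hs _).smul_right _).eq

omit [CompleteSpace A] in
theorem resolventIntegral_congr {f g : ℂ → ℂ}
    (h : ∀ j, ∀ t ∈ Set.Icc (0 : ℝ) 1, f (Γ j t) = g (Γ j t)) :
    resolventIntegral Γ a f = resolventIntegral Γ a g := by
  unfold resolventIntegral
  congr 1
  refine Finset.sum_congr rfl fun j _ => contourIntegral_congr fun t ht => ?_
  rw [h j t ht]

theorem resolventIntegral_add (hΓ : ∀ j, ContDiff ℝ 1 (Γ j))
    (hσ : ∀ j, ∀ t ∈ Set.Icc (0 : ℝ) 1, Γ j t ∉ spectrum ℂ a) {f g : ℂ → ℂ}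
    (hf : ∀ j, ContinuousOn (fun t => f (Γ j t)) (Set.Icc 0 1))
    (hg : ∀ j, ContinuousOn (fun t => g (Γ j t)) (Set.Icc 0 1)) :
    resolventIntegral Γ a (fun z => f z + g z) =
      resolventIntegral Γ a f + resolventIntegral Γ a g := by
  unfold resolventIntegral
  rw [← smul_add, ← Finset.sum_add_distrib]
  congr 1
  refine Finset.sum_congr rfl fun j _ => ?_
  rw [← contourIntegral_add (hΓ j) (continuousOn_smul_resolvent hΓ hσ (hf j))
    (continuousOn_smul_resolvent hΓ hσ (hg j))]
  simp only [add_smul]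

omit [CompleteSpace A] in
theorem resolventIntegral_const_mul (c : ℂ) (f : ℂ → ℂ) :
    resolventIntegral Γ a (fun z => c * f z) = c • resolventIntegral Γ a f := by
  unfold resolventIntegral contourIntegral
  rw [smul_comm c]
  congr 1
  rw [Finset.smul_sum]
  refine Finset.sum_congr rfl fun j _ => ?_
  rw [← intervalIntegral.integral_smul]
  simp only [mul_smul, smul_comm c]

/-- `(a - μ) ∫ g(z) (z - a)⁻¹ dz = ∫ (z - μ) g(z) (z - a)⁻¹ dz - ∫ g(z) dz`. -/
theorem sub_mul_resolventIntegral (hΓ : ∀ j, ContDiff ℝ 1 (Γ j))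
    (hσ : ∀ j, ∀ t ∈ Set.Icc (0 : ℝ) 1, Γ j t ∉ spectrum ℂ a) {g : ℂ → ℂ}
    (hg : ∀ j, ContinuousOn (fun t => g (Γ j t)) (Set.Icc 0 1)) (μ : ℂ) :
    (a - algebraMap ℂ A μ) * resolventIntegral Γ a g =
      resolventIntegral Γ a (fun z => (z - μ) * g z) -
        algebraMap ℂ A ((2 * Real.pi * Complex.I : ℂ)⁻¹ * ∑ j, contourIntegral (Γ j) g) := by
  rw [mul_resolventIntegral hΓ hσ hg, Algebra.algebraMap_eq_smul_one (_ * _), mul_smul]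
  unfold resolventIntegral
  rw [← smul_sub, Finset.sum_smul, ← Finset.sum_sub_distrib]
  congr 1
  refine Finset.sum_congr rfl fun j _ => ?_
  rw [← contourIntegral_smul_const, ← contourIntegral_sub (hΓ j)]
  · refine contourIntegral_congr fun t ht => ?_
    have h1 := sub_mul_resolvent (hσ j t ht)
    have h2 : a - algebraMap ℂ A μ = algebraMap ℂ A (Γ j t - μ) - (algebraMap ℂ A (Γ j t) - a) := by
      rw [map_sub]; abel
    rw [mul_smul_comm, h2, sub_mul, h1, smul_sub, ← Algebra.smul_def, smul_smul, mul_comm]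
  · exact continuousOn_smul_resolvent (g := fun z => (z - μ) * g z) hΓ hσ
      (((hΓ j).continuous.sub continuous_const).continuousOn.mul (hg j))
  · exact (hg j).smul continuousOn_const

/-- The resolvent equation for the Cauchy transform of the resolvent. -/
theorem sub_mul_resolventIntegral_inv (hΓ : ∀ j, ContDiff ℝ 1 (Γ j))
    (hσ : ∀ j, ∀ t ∈ Set.Icc (0 : ℝ) 1, Γ j t ∉ spectrum ℂ a) {w : ℂ}
    (hw : ∀ j, ∀ t ∈ Set.Icc (0 : ℝ) 1, Γ j t ≠ w) :
    (a - algebraMap ℂ A w) * resolventIntegral Γ a (fun z => (z - w)⁻¹) =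
      resolventIntegral Γ a (fun _ => 1) -
        algebraMap ℂ A (∑ j, windingNumber (Γ j) w) := by
  rw [sub_mul_resolventIntegral hΓ hσ fun j => continuousOn_inv_sub (hΓ j) (hw j)]
  congr 1
  · refine resolventIntegral_congr fun j t ht => ?_
    exact mul_inv_cancel₀ (sub_ne_zero.mpr (hw j t ht))
  · rw [Finset.mul_sum]
    rfl

theorem differentiableAt_resolventIntegral_inv (hΓ : ∀ j, ContDiff ℝ 1 (Γ j))
    (hσ : ∀ j, ∀ t ∈ Set.Icc (0 : ℝ) 1, Γ j t ∉ spectrum ℂ a) {w : ℂ}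
    (hw : ∀ j, ∀ t ∈ Set.Icc (0 : ℝ) 1, Γ j t ≠ w) :
    DifferentiableAt ℂ (fun w => resolventIntegral Γ a (fun z => (z - w)⁻¹)) w := by
  unfold resolventIntegral
  refine DifferentiableAt.fun_const_smul (E := ℂ) (DifferentiableAt.fun_sum fun j _ => ?_) _
  refine differentiableAt_cauchyTransform (hΓ j) (fun t ht => ?_) (hw j)
  exact ((continuousAt_resolvent (hσ j t ht)).comp
    (hΓ j).continuous.continuousAt).continuousWithinAt

theorem isOpen_setOf_sum_windingNumber_eq (hΓ : ∀ j, ContDiff ℝ 1 (Γ j))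
    (hclosed : ∀ j, Γ j 0 = Γ j 1) (n : ℂ) :
    IsOpen {w : ℂ | (∀ j, ∀ t ∈ Set.Icc (0 : ℝ) 1, Γ j t ≠ w) ∧
      ∑ j, windingNumber (Γ j) w = n} := by
  rw [Metric.isOpen_iff]
  rintro w ⟨hw, hn⟩
  obtain ⟨r, hr, hball⟩ := exists_ball_sum_contourIntegral_eq hΓ hclosed hw
  refine ⟨r, hr, fun z hz => ⟨(hball z hz).1, ?_⟩⟩
  rw [← hn]
  refine Finset.sum_congr rfl fun j _ => ?_
  rw [windingNumber, (hball z hz).2 j, windingNumber]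

variable {U : Set ℂ}

omit [CompleteSpace A] in
theorem Surrounds.notMem_spectrum (h : Surrounds Γ (spectrum ℂ a) U) (j : Fin m) :
    ∀ t ∈ Set.Icc (0 : ℝ) 1, Γ j t ∉ spectrum ℂ a := fun t ht => (h.mem j t ht).2

omit [CompleteSpace A] in
theorem Surrounds.continuousOn {K : Set ℂ} (h : Surrounds Γ K U) {g : ℂ → ℂ}
    (hg : ContinuousOn g U) (j : Fin m) :
    ContinuousOn (fun t => g (Γ j t)) (Set.Icc 0 1) :=
  hg.comp (h.contDiff j).continuous.continuousOn fun t ht => (h.mem j t ht).1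

/-- On the open set of winding number one, which contains the spectrum, the Cauchy transform of the
resolvent multiplied by `a - w` is the constant (integral minus 1). `eq_zero_of_sub_mul_eq` forces
this constant to vanish. -/
theorem Surrounds.resolventIntegral_one (h : Surrounds Γ (spectrum ℂ a) U) :
    resolventIntegral Γ a (fun _ => 1) = 1 := by
  rw [← sub_eq_zero]
  refine eq_zero_of_sub_mul_eq (a := a)
    (isOpen_setOf_sum_windingNumber_eq h.contDiff h.closed 1) (fun w hw => ⟨?_, ?_⟩)
    (y := fun w => resolventIntegral Γ a (fun z => (z - w)⁻¹)) (fun w hw => ?_) (fun w hw => ?_)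
  · exact fun j t ht he => (h.mem j t ht).2 (he ▸ hw)
  · exact h.winding_eq_one w hw
  · exact (differentiableAt_resolventIntegral_inv h.contDiff h.notMem_spectrum
      hw.1).differentiableWithinAt
  · rw [sub_mul_resolventIntegral_inv h.contDiff h.notMem_spectrum hw.1, hw.2, map_one]

/-- Replacing z - μ by a - μ under the integral costs only the scalar integral of g, which is zero
by Cauchy's theorem. This special case of multiplicativity is all that is used. -/
theorem Surrounds.resolventIntegral_sub_mul (h : Surrounds Γ (spectrum ℂ a) U) (hU : IsOpen U)
    {g : ℂ → ℂ} (hg : DifferentiableOn ℂ g U) (μ : ℂ) :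
    resolventIntegral Γ a (fun z => (z - μ) * g z) =
      (a - algebraMap ℂ A μ) * resolventIntegral Γ a g := by
  rw [sub_mul_resolventIntegral h.contDiff h.notMem_spectrum
    (fun j => h.continuousOn hg.continuousOn j),
    sum_contourIntegral_eq_zero_of_winding hU h.contDiff h.closed
      (fun j t ht => (h.mem j t ht).1) (fun w hw => ?_) hg, mul_zero, map_zero, sub_zero]
  have := h.winding_eq_zero w hw
  unfold windingNumber at this
  rw [← Finset.mul_sum] at this
  exact (mul_eq_zero.mp this).resolve_left (inv_ne_zero Complex.two_pi_I_ne_zero)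

theorem Surrounds.resolventIntegral_sub_pow_mul (h : Surrounds Γ (spectrum ℂ a) U)
    (hU : IsOpen U) {g : ℂ → ℂ} (hg : DifferentiableOn ℂ g U) (μ : ℂ) (n : ℕ) :
    resolventIntegral Γ a (fun z => (z - μ) ^ n * g z) =
      (a - algebraMap ℂ A μ) ^ n * resolventIntegral Γ a g := by
  induction n with
  | zero => simp
  | succ n ih =>
    rw [pow_succ', mul_assoc, ← ih, ← h.resolventIntegral_sub_mul hU]
    · simp only [pow_succ', mul_assoc]
    · exact ((differentiableOn_id.sub_const μ).pow n).mul hg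

theorem Surrounds.resolventIntegral_eval (h : Surrounds Γ (spectrum ℂ a) U) (hU : IsOpen U)
    (P : Polynomial ℂ) :
    resolventIntegral Γ a (fun z => P.eval z) = Polynomial.aeval a P := by
  induction P using Polynomial.induction_on' with
  | add p q hp hq =>
    rw [map_add, ← hp, ← hq, ← resolventIntegral_add h.contDiff h.notMem_spectrum
      (fun j => h.continuousOn p.continuous.continuousOn j)
      (fun j => h.continuousOn q.continuous.continuousOn j)]
    simp only [Polynomial.eval_add]
  | monomial n c =>
    have h1 := h.resolventIntegral_sub_pow_mul hU (g := fun _ => 1) (differentiableOn_const 1) 0 n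
    rw [h.resolventIntegral_one, mul_one, map_zero, sub_zero] at h1
    simp only [sub_zero, mul_one] at h1
    simp only [Polynomial.eval_monomial]
    rw [resolventIntegral_const_mul, h1, Polynomial.aeval_monomial, Algebra.smul_def]

end Calculus

/-! ### Circles as explicit cycles. -/

section Circle

/-- The circle of centre `c` and radius `r`, parametrized by `[0, 1]`. -/
def circlePath (c : ℂ) (r : ℝ) (t : ℝ) : ℂ := c + r * Complex.exp (2 * Real.pi * Complex.I * t)

theorem hasDerivAt_circlePath (c : ℂ) (r t : ℝ) : HasDerivAt (circlePath c r)
    (2 * Real.pi * Complex.I * (circlePath c r t - c)) t := by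
  have h1 : HasDerivAt (fun t : ℝ => (2 * Real.pi * Complex.I * t : ℂ)) (2 * Real.pi * Complex.I) t := by
    simpa using (Complex.ofRealCLM.hasDerivAt (x := t)).const_mul (2 * Real.pi * Complex.I : ℂ)
  refine ((h1.cexp.const_mul (r : ℂ)).const_add c).congr_deriv ?_
  unfold circlePath
  ring

theorem contDiff_circlePath (c : ℂ) (r : ℝ) : ContDiff ℝ 1 (circlePath c r) := by
  unfold circlePath
  refine contDiff_const.add (contDiff_const.mul (ContDiff.cexp (contDiff_const.mul ?_)))
  exact Complex.ofRealCLM.contDiff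

theorem circlePath_closed (c : ℂ) (r : ℝ) : circlePath c r 0 = circlePath c r 1 := by
  simp [circlePath, Complex.exp_two_pi_mul_I]

theorem norm_circlePath_sub (c : ℂ) {r : ℝ} (hr : 0 ≤ r) (t : ℝ) : ‖circlePath c r t - c‖ = r := by
  have : (2 * Real.pi * Complex.I * t : ℂ) = ((2 * Real.pi * t : ℝ) : ℂ) * Complex.I := by
    push_cast; ring
  rw [circlePath, add_sub_cancel_left, norm_mul, this, Complex.norm_exp_ofReal_mul_I, mul_one,
    Complex.norm_real, Real.norm_of_nonneg hr]

theorem windingNumber_circlePath_of_norm_lt {c w : ℂ} {r : ℝ} (hw : ‖w - c‖ < r) :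
    windingNumber (circlePath c r) w = 1 := by
  have hr : 0 < r := (norm_nonneg _).trans_lt hw
  rw [windingNumber, contourIntegral_inv_sub_eq (contDiff_circlePath c r) (circlePath_closed c r)
    (w₀ := c) (fun t _ => by rwa [norm_circlePath_sub c hr.le])]
  have : ∀ t : ℝ, deriv (circlePath c r) t • (circlePath c r t - c)⁻¹ = 2 * Real.pi * Complex.I := by
    intro t
    have h0 : circlePath c r t - c ≠ 0 := by
      rw [← norm_pos_iff, norm_circlePath_sub c hr.le]; exact hr
    rw [(hasDerivAt_circlePath c r t).deriv, smul_eq_mul, mul_assoc, mul_inv_cancel₀ h0, mul_one]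
  rw [contourIntegral, intervalIntegral.integral_congr fun t _ => this t]
  simp only [intervalIntegral.integral_const, sub_zero, one_smul]
  exact inv_mul_cancel₀ Complex.two_pi_I_ne_zero

theorem windingNumber_circlePath_of_lt_norm {c w : ℂ} {r : ℝ} (hr : 0 ≤ r) (hw : r < ‖w - c‖) :
    windingNumber (circlePath c r) w = 0 := by
  rw [windingNumber, contourIntegral_inv_sub_eq_zero (contDiff_circlePath c r)
    (circlePath_closed c r) (c := c) (fun t _ => by rwa [norm_circlePath_sub c hr]), mul_zero]

theorem exists_surrounds_univ {K : Set ℂ} (hK : Bornology.IsBounded K) :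
    ∃ Γ : Fin 1 → ℝ → ℂ, Surrounds Γ K Set.univ := by
  obtain ⟨r, hr⟩ := hK.subset_ball_lt 0 0
  have hlt : ∀ w ∈ K, ‖w - 0‖ < r := fun w hw => mem_ball_iff_norm.mp (hr.2 hw)
  refine ⟨fun _ => circlePath 0 r, ⟨fun _ => contDiff_circlePath 0 r,
    fun _ => circlePath_closed 0 r, fun _ t _ => ⟨trivial, fun h => ?_⟩, fun w hw => ?_,
    fun w hw => absurd trivial hw⟩⟩
  · have := hlt _ h
    rw [norm_circlePath_sub 0 hr.1.le] at this
    exact lt_irrefl _ this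
  · simp [windingNumber_circlePath_of_norm_lt (hlt w hw)]

end Circle

/-! ### From f(a) back to a. -/

section FunctionOf

theorem exists_eq_pow_mul {f : ℂ → ℂ} {U : Set ℂ} (hf : AnalyticOnNhd ℂ f U)
    {μ : ℂ} (hμ : μ ∈ U) (hne : ¬ ∀ᶠ z in 𝓝 μ, f z = f μ) :
    ∃ (n : ℕ) (g : ℂ → ℂ), n ≠ 0 ∧ DifferentiableOn ℂ g U ∧ g μ ≠ 0 ∧
      ∀ z, f z - f μ = (z - μ) ^ n * g z := by
  have hfμ : AnalyticAt ℂ (fun z => f z - f μ) μ := (hf μ hμ).sub analyticAt_const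
  obtain ⟨n, g₀, hg₀, hg₀μ, heq⟩ := hfμ.exists_eventuallyEq_pow_smul_nonzero_iff.mpr
    (by simpa only [sub_eq_zero] using hne)
  have hn : n ≠ 0 := by
    rintro rfl
    have := heq.self_of_nhds
    simp only [sub_self, pow_zero, one_smul] at this
    exact hg₀μ this.symm
  let g : ℂ → ℂ := Function.update (fun z => (f z - f μ) / (z - μ) ^ n) μ (g₀ μ)
  have hgμ : g μ = g₀ μ := Function.update_self ..
  have hgne : ∀ z ≠ μ, g z = (f z - f μ) / (z - μ) ^ n := fun z hz => Function.update_of_ne hz _ _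
  refine ⟨n, g, hn, fun z hz => ?_, by rwa [hgμ], fun z => ?_⟩
  · refine DifferentiableAt.differentiableWithinAt ?_
    by_cases hzμ : z = μ
    · subst hzμ
      refine hg₀.differentiableAt.congr_of_eventuallyEq ?_
      filter_upwards [heq] with w hw
      by_cases hwz : w = z
      · rw [hwz, hgμ]
      · rw [hgne w hwz, hw, smul_eq_mul,
          mul_div_cancel_left₀ _ (pow_ne_zero n (sub_ne_zero.mpr hwz))]
    · have h1 : DifferentiableAt ℂ (fun z => (f z - f μ) / (z - μ) ^ n) z :=
        ((hf z hz).differentiableAt.sub_const _).div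
          ((differentiableAt_id.sub_const μ).pow n) (pow_ne_zero n (sub_ne_zero.mpr hzμ))
      refine h1.congr_of_eventuallyEq ?_
      filter_upwards [isOpen_ne.mem_nhds hzμ] with w hw
      exact hgne w hw
  · by_cases hzμ : z = μ
    · rw [hzμ, sub_self, sub_self, zero_pow hn, zero_mul]
    · rw [hgne z hzμ, mul_div_cancel₀ _ (pow_ne_zero n (sub_ne_zero.mpr hzμ))]

variable {A : Type*} [NormedRing A] [NormedAlgebra ℂ A] [CompleteSpace A]

/-- If `f(a) - f(μ)` is Drazin invertible and `f` is not constant near `μ`, then `a - μ` is Drazin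
invertible. -/
theorem Surrounds.isDrazin_sub {m : ℕ} {Γ : Fin m → ℝ → ℂ} {a : A} {U : Set ℂ}
    (h : Surrounds Γ (spectrum ℂ a) U) (hU : IsOpen U) {f : ℂ → ℂ} (hf : AnalyticOnNhd ℂ f U)
    {μ : ℂ} (hμ : μ ∈ U) (hne : ¬ ∀ᶠ z in 𝓝 μ, f z = f μ)
    (hd : IsDrazin (resolventIntegral Γ a f - algebraMap ℂ A (f μ))) :
    IsDrazin (a - algebraMap ℂ A μ) := by
  obtain ⟨n, g, hn, hg, hgμ, hfg⟩ := exists_eq_pow_mul hf hμ hne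
  have hconst : ∀ (c : ℂ) (j : Fin m), ContinuousOn (fun _ : ℝ => c) (Set.Icc 0 1) :=
    fun c j => continuousOn_const
  have hds : DifferentiableOn ℂ (dslope g μ) U :=
    (Complex.differentiableOn_dslope (hU.mem_nhds hμ)).mpr hg
  have e1 : resolventIntegral Γ a f - algebraMap ℂ A (f μ) =
      (a - algebraMap ℂ A μ) ^ n * resolventIntegral Γ a g := by
    have h1 : resolventIntegral Γ a f = resolventIntegral Γ a (fun z => (z - μ) ^ n * g z) +
        resolventIntegral Γ a (fun z => f μ * 1) := by
      rw [← resolventIntegral_add h.contDiff h.notMem_spectrum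
        (fun j => h.continuousOn (g := fun z => (z - μ) ^ n * g z)
          (((differentiableOn_id.sub_const μ).pow n).mul hg).continuousOn j)
        (hconst _)]
      exact resolventIntegral_congr fun j t _ => by rw [← hfg, mul_one, sub_add_cancel]
    rw [h1, resolventIntegral_const_mul, h.resolventIntegral_one,
      h.resolventIntegral_sub_pow_mul hU hg, ← Algebra.algebraMap_eq_smul_one, add_sub_cancel_right]
  -- A Bézout relation: g(z) = g(μ) + (z - μ) (dslope g μ z), divided by g(μ), shows that a - μ and
  -- g(a) are comaximal, as `IsDrazin.of_pow_mul` requires.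
  have e2 : (a - algebraMap ℂ A μ) * resolventIntegral Γ a (fun z => -(g μ)⁻¹ * dslope g μ z) +
      (g μ)⁻¹ • resolventIntegral Γ a g = 1 := by
    rw [← h.resolventIntegral_sub_mul hU (hds.const_mul _), ← resolventIntegral_const_mul,
      ← resolventIntegral_add h.contDiff h.notMem_spectrum
        (fun j => h.continuousOn (g := fun z => (z - μ) * (-(g μ)⁻¹ * dslope g μ z))
          ((differentiableOn_id.sub_const μ).mul (hds.const_mul _)).continuousOn j)
        (fun j => h.continuousOn (g := fun z => (g μ)⁻¹ * g z) (hg.const_mul _).continuousOn j),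
      ← h.resolventIntegral_one]
    refine resolventIntegral_congr fun j t _ => ?_
    have h1 := sub_smul_dslope g μ (Γ j t)
    rw [smul_eq_mul] at h1
    rw [mul_left_comm, h1]
    field_simp
    ring
  have hcomm : ∀ {k : ℂ → ℂ}, ContinuousOn k U →
      Commute (a - algebraMap ℂ A μ) (resolventIntegral Γ a k) := fun hk =>
    commute_resolventIntegral h.contDiff h.notMem_spectrum (fun j => h.continuousOn hk j)
      ((Commute.refl a).sub_left (Algebra.commutes μ a))
  refine IsDrazin.of_pow_mul hn ((hcomm hg.continuousOn).smul_right _)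
    (hcomm (hds.const_mul _).continuousOn) e2 ?_
  refine IsDrazin.of_mul_unit (b := algebraMap ℂ A (g μ)) ((IsUnit.mk0 _ hgμ).map _)
    (Algebra.commutes _ _).symm ?_
  rwa [mul_smul_comm, ← e1, ← Algebra.commutes, ← Algebra.smul_def, smul_smul,
    mul_inv_cancel₀ hgμ, one_smul]

end FunctionOf

/-! ### Conditions 1 and 2 against the Drazin spectrum. -/

section Operators

variable {X : Type*} [NormedAddCommGroup X] [NormedSpace ℂ X] [CompleteSpace X]

theorem exists_isFunctionOf_of_polynomial {T S : X →L[ℂ] X} {P : Polynomial ℂ}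
    (hP : 1 ≤ P.natDegree) (h : IsMeromorphic (Polynomial.aeval S P)) :
    ∃ (U : Set ℂ) (f : ℂ → ℂ), IsOpen U ∧ spectrum ℂ T ∪ spectrum ℂ S ⊆ U ∧
      AnalyticOnNhd ℂ f U ∧
      (∀ z ∈ spectrum ℂ T, ¬ ∃ c : ℂ, ∀ w ∈ connectedComponentIn U z, f w = c) ∧
      ∃ A : X →L[ℂ] X, IsFunctionOf S U f A ∧ IsMeromorphic A := by
  obtain ⟨Γ, hΓ⟩ := exists_surrounds_univ (spectrum.isBounded (𝕜 := ℂ) S)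
  refine ⟨Set.univ, fun z => P.eval z, isOpen_univ, Set.subset_univ _, ?_, ?_, _,
    ⟨1, Γ, hΓ, (hΓ.resolventIntegral_eval isOpen_univ P).symm⟩, h⟩
  · exact fun z _ => AnalyticOnNhd.eval_polynomial P z trivial
  · rintro z - ⟨c, hc⟩
    rw [connectedComponentIn_univ, PreconnectedSpace.connectedComponent_eq_univ] at hc
    have : P = Polynomial.C c := Polynomial.funext fun w => by simp [hc w trivial]
    rw [this, Polynomial.natDegree_C] at hP
    exact absurd hP (by norm_num)

omit [CompleteSpace X] in
theorem IsDrazin.perturb {T F : X →L[ℂ] X} (hTF : Commute T F) {n : ℕ}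
    (hF : FiniteDimensional ℂ (F ^ n).range) {l : ℂ}
    (h : IsDrazin (T - algebraMap ℂ (X →L[ℂ] X) l)) :
    IsDrazin (T + F - algebraMap ℂ (X →L[ℂ] X) l) := by
  have := h.add_of_finiteDimensional_range_pow (hTF.sub_left (Algebra.commutes l F)) hF
  rwa [sub_add_eq_add_sub] at this

omit [CompleteSpace X] in
theorem IsDrazin.of_perturb {T F : X →L[ℂ] X} (hTF : Commute T F) {n : ℕ}
    (hF : FiniteDimensional ℂ (F ^ n).range) {l : ℂ}
    (h : IsDrazin (T + F - algebraMap ℂ (X →L[ℂ] X) l)) :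
    IsDrazin (T - algebraMap ℂ (X →L[ℂ] X) l) := by
  have hF' : FiniteDimensional ℂ ((-F) ^ n).range := by
    refine finiteDimensional_range_of_mul_eq (b := (-1) ^ n) hF ?_
    rw [← neg_one_mul, (Commute.neg_one_left F).mul_pow]
    exact ((Commute.neg_one_left F).pow_pow n n).eq
  have := IsDrazin.perturb (T := T + F) (F := -F)
    ((hTF.add_left (Commute.refl F)).neg_right) hF' h
  rwa [add_neg_cancel_right] at this

theorem finite_drazinSpectrum_of_isFunctionOf {T F : X →L[ℂ] X} (hTF : Commute T F) {n : ℕ}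
    (hF : FiniteDimensional ℂ (F ^ n).range) {U : Set ℂ} {f : ℂ → ℂ} (hU : IsOpen U)
    (hσ : spectrum ℂ T ⊆ U) (hf : AnalyticOnNhd ℂ f U)
    (hne : ∀ z ∈ spectrum ℂ T, ¬ ∃ c : ℂ, ∀ w ∈ connectedComponentIn U z, f w = c)
    {A : X →L[ℂ] X} (hA : IsFunctionOf (T + F) U f A) (hmer : IsMeromorphic A) :
    (drazinSpectrum T).Finite := by
  obtain ⟨m, Γ, hΓ, hAΓ⟩ := hA
  -- Identity theorem on the component of z. It is used twice: f is not locally constant at points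
  -- of σ(T), and its zeros do not accumulate there.
  have hloc : ∀ z ∈ spectrum ℂ T, ∀ c : ℂ, ¬ ∃ᶠ w in 𝓝[≠] z, f w = c := by
    intro z hz c hfreq
    refine hne z hz ⟨c, fun w hw => ?_⟩
    have hsub : AnalyticOnNhd ℂ (fun w => f w - c) (connectedComponentIn U z) := fun w hw =>
      (hf w (connectedComponentIn_subset U z hw)).sub analyticAt_const
    exact sub_eq_zero.mp (hsub.eqOn_zero_of_preconnected_of_frequently_eq_zero
      isPreconnected_connectedComponentIn (mem_connectedComponentIn (hσ hz))
      (hfreq.mono fun w hw => sub_eq_zero.mpr hw) hw)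
  have hsub : drazinSpectrum T ⊆ {z ∈ spectrum ℂ T | f z = 0} := by
    intro z hz
    have hzσ : z ∈ spectrum ℂ T := by
      by_contra h
      exact hz (isDrazin_sub_algebraMap_of_notMem_spectrum h)
    refine ⟨hzσ, ?_⟩
    by_contra hfz
    -- The calculus is that of T + F, while z is a spectral point of T. The point z need only lie in
    -- U, and the conclusion for T + F is carried back to T by perturbation.
    refine hz (IsDrazin.of_perturb hTF hF (hΓ.isDrazin_sub hU hf (hσ hzσ) (fun hev => ?_) ?_))
    · exact hloc z hzσ (f z) (Filter.Eventually.frequently (hev.filter_mono inf_le_left))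
    · have h1 := isMeromorphic_iff.mp hmer (f z) hfz
      rw [hAΓ] at h1
      exact h1
  refine Set.Finite.subset ?_ hsub
  by_contra hinf
  obtain ⟨z, hz, hacc⟩ := Set.Infinite.exists_accPt_of_subset_isCompact hinf
    (spectrum.isCompact (𝕜 := ℂ) T) (fun z hz => hz.1)
  rw [accPt_iff_frequently_nhdsNE] at hacc
  exact hloc z hz 0 (hacc.mono fun w hw => hw.2)

theorem exists_polynomial_isMeromorphic {S : X →L[ℂ] X} (h : (drazinSpectrum S).Finite) :
    ∃ P : Polynomial ℂ, 1 ≤ P.natDegree ∧ IsMeromorphic (Polynomial.aeval S P) := by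
  classical
  let Q : Polynomial ℂ := ∏ z ∈ h.toFinset, (Polynomial.X - Polynomial.C z)
  -- The factor X keeps P non-constant when the Drazin spectrum is empty.
  let P : Polynomial ℂ := Polynomial.X * Q
  have hQ : Q.Monic := Polynomial.monic_prod_X_sub_C _ _
  have hdeg : 1 ≤ P.natDegree := by
    rw [Polynomial.Monic.natDegree_mul Polynomial.monic_X hQ, Polynomial.natDegree_X]
    exact Nat.le_add_right _ _
  have hProot : ∀ z ∈ drazinSpectrum S, P.eval z = 0 := by
    intro z hz
    have : Q.eval z = 0 := by
      rw [Polynomial.eval_prod]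
      exact Finset.prod_eq_zero (h.mem_toFinset.mpr hz) (by simp)
    simp [P, this]
  have hprod : ∀ s : Multiset ℂ, (∀ z ∈ s, IsDrazin (S - algebraMap ℂ (X →L[ℂ] X) z)) →
      IsDrazin (Polynomial.aeval S (s.map fun z => Polynomial.X - Polynomial.C z).prod) := by
    intro s
    induction s using Multiset.induction with
    | empty => intro _; simpa using IsUnit.isDrazin (isUnit_one (M := X →L[ℂ] X))
    | cons z s ih =>
      intro hs
      rw [Multiset.map_cons, Multiset.prod_cons, map_mul]
      refine IsDrazin.mul ?_ (ih fun w hw => hs w (Multiset.mem_cons_of_mem hw))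
        ((Commute.all _ _).map (Polynomial.aeval S))
      simpa using hs z (Multiset.mem_cons_self z s)
  refine ⟨P, hdeg, isMeromorphic_iff.mpr fun l hl => ?_⟩
  have hPl : P - Polynomial.C l ≠ 0 := by
    intro h0
    rw [sub_eq_zero] at h0
    rw [h0, Polynomial.natDegree_C] at hdeg
    exact absurd hdeg (by norm_num)
  have e1 : Polynomial.aeval S P - algebraMap ℂ (X →L[ℂ] X) l =
      algebraMap ℂ (X →L[ℂ] X) (P - Polynomial.C l).leadingCoeff *
      Polynomial.aeval S ((P - Polynomial.C l).roots.map
        fun z => Polynomial.X - Polynomial.C z).prod := by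
    have h1 := (IsAlgClosed.splits (P - Polynomial.C l)).eq_prod_roots
    have h2 := congrArg (Polynomial.aeval S) h1
    rwa [map_mul, map_sub, Polynomial.aeval_C, Polynomial.aeval_C] at h2
  rw [e1]
  refine IsDrazin.mul (IsUnit.isDrazin ((IsUnit.mk0 _ (Polynomial.leadingCoeff_ne_zero.mpr
    hPl)).map _)) (hprod _ fun z hz => ?_) (Algebra.commutes _ _)
  by_contra hD
  rw [Polynomial.mem_roots hPl, Polynomial.IsRoot, Polynomial.eval_sub, hProot z hD,
    Polynomial.eval_C, zero_sub, neg_eq_zero] at hz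
  exact hl hz

end Operators

/-! ### Riesz idempotents and the splitting of the identity. -/

section Splitting

theorem isDrazin_mul_of_mul_eq {A : Type*} [Ring A] {t y e : A} (he : e * e = e)
    (hty : Commute t y) (hey : Commute e y) (h : t * y = e) :
    IsDrazin (t * e) := by
  refine ⟨1, y, hty.mul_left hey, ?_⟩
  calc (t * e) ^ 1 = t * e * e := by rw [pow_one, mul_assoc, he]
    _ = t * e * (t * y * e) := by rw [h, he]
    _ = t * e * (t * e) * y := by rw [mul_assoc t y e, ← hey.eq]; simp only [mul_assoc]
    _ = _ := by rw [one_add_one_eq_two, sq]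

variable {A : Type*} [NormedRing A] [NormedAlgebra ℂ A] [CompleteSpace A]

/-- The Riesz idempotent of a circle that avoids the spectrum. -/
theorem exists_idempotent_of_sphere {a : A} {l : ℂ} {r : ℝ} (hr : 0 < r)
    (hs : ∀ z ∈ spectrum ℂ a, ‖z - l‖ ≠ r) :
    ∃ e : A, e * e = e ∧ (∀ s, Commute s a → Commute s e) ∧
      (∀ w, ‖w - l‖ < r → IsDrazin ((a - algebraMap ℂ A w) * (1 - e))) ∧
      ∀ w, r < ‖w - l‖ → IsDrazin ((a - algebraMap ℂ A w) * e) := by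
  classical
  let Γ : Fin 1 → ℝ → ℂ := fun _ => circlePath l r
  have hΓ : ∀ j, ContDiff ℝ 1 (Γ j) := fun _ => contDiff_circlePath l r
  have hnorm : ∀ j t, ‖Γ j t - l‖ = r := fun _ t => norm_circlePath_sub l hr.le t
  have hσ : ∀ j, ∀ t ∈ Set.Icc (0 : ℝ) 1, Γ j t ∉ spectrum ℂ a := fun j t _ h =>
    hs _ h (hnorm j t)
  have hoff : ∀ {w : ℂ}, ‖w - l‖ ≠ r → ∀ j, ∀ t ∈ Set.Icc (0 : ℝ) 1, Γ j t ≠ w :=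
    fun hw j t _ he => hw (he ▸ hnorm j t)
  set e := resolventIntegral Γ a (fun _ => 1) with he
  let Y : ℂ → A := fun w => resolventIntegral Γ a (fun z => (z - w)⁻¹)
  have hsub : ∀ w, Commute a (a - algebraMap ℂ A w) := fun w =>
    commute_sub_algebraMap (Commute.refl a) w
  have hecomm : ∀ s, Commute s a → Commute s e := fun s hsa =>
    commute_resolventIntegral hΓ hσ (fun _ => continuousOn_const) hsa
  have hYcomm : ∀ w, ‖w - l‖ ≠ r → ∀ s, Commute s a → Commute s (Y w) := fun w hw s hsa =>
    commute_resolventIntegral hΓ hσ (fun j => continuousOn_inv_sub (hΓ j) (hoff hw j)) hsa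
  have hin : ∀ w, ‖w - l‖ < r → (a - algebraMap ℂ A w) * Y w = e - 1 := by
    intro w hw
    rw [sub_mul_resolventIntegral_inv hΓ hσ (hoff hw.ne)]
    simp [Γ, windingNumber_circlePath_of_norm_lt hw]; rfl
  have hout : ∀ w, r < ‖w - l‖ → (a - algebraMap ℂ A w) * Y w = e := by
    intro w hw
    rw [sub_mul_resolventIntegral_inv hΓ hσ (hoff hw.ne')]
    simp [Γ, windingNumber_circlePath_of_lt_norm hr.le hw]; rfl
  have hea : ∀ w, Commute (a - algebraMap ℂ A w) e := fun w => hecomm _ (hsub w).symm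
  -- Idempotency without a double integral: -e Y(w) inside the circle and (1 - e) Y(w) outside both
  -- give e (1 - e) after multiplication by a - w. Together they are holomorphic off the circle,
  -- hence near the spectrum.
  have hidem : e * (1 - e) = 0 := by
    let y : ℂ → A := fun w => if ‖w - l‖ < r then -(e * Y w) else (1 - e) * Y w
    have hcontn : Continuous fun w : ℂ => ‖w - l‖ := by fun_prop
    have hYd : ∀ w, ‖w - l‖ ≠ r → DifferentiableAt ℂ Y w := fun w hw =>
      differentiableAt_resolventIntegral_inv hΓ hσ (hoff hw)
    refine eq_zero_of_sub_mul_eq (a := a) (V := {w | ‖w - l‖ ≠ r})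
      (isOpen_ne_fun hcontn continuous_const) hs (y := y) (fun w hw => ?_) (fun w hw => ?_)
    · refine DifferentiableAt.differentiableWithinAt ?_
      rcases lt_or_gt_of_ne hw with h | h
      · refine DifferentiableAt.congr_of_eventuallyEq (((hYd w hw).const_mul e).neg) ?_
        filter_upwards [(isOpen_lt hcontn continuous_const).mem_nhds h] with z hz
        exact if_pos hz
      · refine DifferentiableAt.congr_of_eventuallyEq ((hYd w hw).const_mul (1 - e)) ?_
        filter_upwards [(isOpen_lt continuous_const hcontn).mem_nhds h] with z hz
        exact if_neg (not_lt.mpr (le_of_lt hz))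
    · rcases lt_or_gt_of_ne hw with h | h
      · rw [show y w = -(e * Y w) from if_pos h, mul_neg, ← mul_assoc, (hea w).eq, mul_assoc,
          hin w h, ← mul_neg, neg_sub]
      · rw [show y w = (1 - e) * Y w from if_neg (not_lt.mpr h.le), ← mul_assoc,
          ((Commute.one_right _).sub_right (hea w)).eq, mul_assoc, hout w h, mul_sub, sub_mul]
        simp
  have hee : e * e = e := by
    rw [mul_sub, mul_one, sub_eq_zero] at hidem
    exact hidem.symm
  have hee' : (1 - e) * (1 - e) = 1 - e := by
    rw [sub_mul, one_mul, hidem, sub_zero]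
  have hYe : ∀ w, ‖w - l‖ ≠ r → Commute e (Y w) := fun w hw =>
    hYcomm w hw e (hecomm a (Commute.refl a)).symm
  refine ⟨e, hee, hecomm, fun w hw => ?_, fun w hw => ?_⟩
  · refine isDrazin_mul_of_mul_eq (y := -Y w) hee'
      (hYcomm w hw.ne _ (hsub w).symm).neg_right
      ((Commute.one_left _).sub_left (hYe w hw.ne)).neg_right ?_
    rw [mul_neg, hin w hw, neg_sub]
  · exact isDrazin_mul_of_mul_eq hee (hYcomm w hw.ne' _ (hsub w).symm)
      (hYe w hw.ne') (hout w hw)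

/-- In a punctured disc of radius δ about `l` all points are Drazin, so spectral points cannot
accumulate there. The annulus from δ/4 to δ/2 thus contains finitely many of them, and some radius
in between avoids them all. -/
theorem exists_radius {a : A} (hD : {z : ℂ | ¬ IsDrazin (a - algebraMap ℂ A z)}.Finite) (l : ℂ) :
    ∃ r > 0, (∀ z ∈ spectrum ℂ a, ‖z - l‖ ≠ r) ∧
      ∀ z ≠ l, ¬ IsDrazin (a - algebraMap ℂ A z) → r < ‖z - l‖ := by
  obtain ⟨δ, hδ, hball⟩ : ∃ δ > 0, ∀ z ∈ Metric.ball l δ, z ≠ l →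
      IsDrazin (a - algebraMap ℂ A z) := by
    have h1 : IsClosed ({z : ℂ | ¬ IsDrazin (a - algebraMap ℂ A z)} \ {l}) :=
      (hD.subset Set.sdiff_subset).isClosed
    obtain ⟨δ, hδ, hsub⟩ := Metric.isOpen_iff.mp h1.isOpen_compl l (by simp)
    refine ⟨δ, hδ, fun z hz hzl => ?_⟩
    by_contra h
    exact hsub hz ⟨h, hzl⟩
  let C : Set ℂ := {z ∈ spectrum ℂ a | δ / 4 ≤ ‖z - l‖ ∧ ‖z - l‖ ≤ δ / 2}
  have hcontn : Continuous fun w : ℂ => ‖w - l‖ := by fun_prop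
  have hC : IsCompact C := (spectrum.isCompact a).inter_right
    ((isClosed_le continuous_const hcontn).inter (isClosed_le hcontn continuous_const))
  have hfin : C.Finite := by
    by_contra hinf
    obtain ⟨z, hz, hacc⟩ := Set.Infinite.exists_accPt_of_subset_isCompact hinf hC subset_rfl
    have hzl : z ≠ l := by
      rintro rfl
      have := hz.2.1
      rw [sub_self, norm_zero] at this
      linarith
    have hd := hball z (mem_ball_iff_norm.mpr (by linarith [hz.2.2])) hzl
    rw [accPt_iff_frequently_nhdsNE] at hacc
    obtain ⟨w, hw, hw'⟩ := (hacc.and_eventually hd.exists_analyticAt.1).exists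
    exact hw' hw.1
  obtain ⟨r, hr, hrC⟩ := (Set.Ioo_infinite (show δ / 4 < δ / 2 by linarith)).exists_notMem_finite
    (hfin.image fun z => ‖z - l‖)
  refine ⟨r, by linarith [hr.1], fun z hz he => hrC ⟨z, ⟨hz, ?_, ?_⟩, he⟩, fun z hzl hzD => ?_⟩
  · rw [he]; exact hr.1.le
  · rw [he]; exact hr.2.le
  · by_contra hlt
    exact hzD (hball z (mem_ball_iff_norm.mpr (by linarith [hr.2])) hzl)

theorem exists_idempotent_of_finite {a : A}
    (hD : {z : ℂ | ¬ IsDrazin (a - algebraMap ℂ A z)}.Finite) (l : ℂ) :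
    ∃ e : A, e * e = e ∧ (∀ s, Commute s a → Commute s e) ∧
      IsDrazin ((a - algebraMap ℂ A l) * (1 - e)) ∧
      ∀ w ≠ l, IsDrazin ((a - algebraMap ℂ A w) * e) := by
  obtain ⟨r, hr, hrσ, hrD⟩ := exists_radius hD l
  obtain ⟨e, hee, hecomm, hin, hout⟩ := exists_idempotent_of_sphere hr hrσ
  refine ⟨e, hee, hecomm, hin l (by simpa using hr), fun w hw => ?_⟩
  by_cases hwD : IsDrazin (a - algebraMap ℂ A w)
  · exact hwD.mul (IsIdempotentElem.isDrazin hee)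
      (hecomm _ (commute_sub_algebraMap (Commute.refl a) w).symm)
  · exact hout w (hrD w hw hwD)

/-- Induction on the set of possible Drazin points of the corner `f`. The idempotent `p` of a circle
about `l` splits off `f * p`, whose only possible Drazin point is `l`, and the remainder `f * (1 -
p)` no longer has `l`. The corner is left general so that the induction applies to the remainder. -/
theorem exists_orthogonal_idempotents {a : A}
    (hD : {z : ℂ | ¬ IsDrazin (a - algebraMap ℂ A z)}.Finite) (s : Finset ℂ) {f : A}
    (hf : f * f = f) (hfa : Commute a f)
    (hfs : ∀ w ∉ s, IsDrazin ((a - algebraMap ℂ A w) * f)) :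
    ∃ (n : ℕ) (e : Fin n → A), (∀ i, e i * e i = e i) ∧ (∀ i j, i ≠ j → e i * e j = 0) ∧
      (∀ i, Commute a (e i)) ∧ (∀ i, e i * f = e i) ∧ (∀ i, f * e i = e i) ∧ ∑ i, e i = f ∧
      ∀ i, ∃ l, ∀ w ≠ l, IsDrazin ((a - algebraMap ℂ A w) * e i) := by
  classical
  induction s using Finset.induction generalizing f with
  | empty =>
    refine ⟨1, fun _ => f, fun _ => hf, fun i j hij => absurd (Subsingleton.elim i j) hij,
      fun _ => hfa, fun _ => hf, fun _ => hf, by simp, fun _ => ⟨0, fun w _ => hfs w (by simp)⟩⟩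
  | insert l s hl ih =>
    obtain ⟨p, hp, hpc, hpl, hpw⟩ := exists_idempotent_of_finite hD l
    have hfp : Commute f p := hpc f hfa.symm
    have hap : Commute a p := hpc a (Commute.refl a)
    have hfp' : Commute f (1 - p) := (Commute.one_right f).sub_right hfp
    have hap' : Commute a (1 - p) := (Commute.one_right a).sub_right hap
    have hp' : (1 - p) * (1 - p) = 1 - p := by
      rw [mul_sub, mul_one, sub_mul, one_mul, hp]; abel
    have hpp' : p * (1 - p) = 0 := by rw [mul_sub, mul_one, hp, sub_self]
    have hp'p : (1 - p) * p = 0 := by rw [sub_mul, one_mul, hp, sub_self]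
    have mulidem : ∀ {x y : A}, Commute x y → x * x = x → y * y = y →
        x * y * (x * y) = x * y := fun hxy hx hy => by
      rw [hxy.symm.mul_mul_mul_comm, hx, hy]
    have hf1 : f * p * (f * p) = f * p := mulidem hfp hf hp
    have hf2 : f * (1 - p) * (f * (1 - p)) = f * (1 - p) := mulidem hfp' hf hp'
    have hf12 : f * p * (f * (1 - p)) = 0 := by
      rw [hfp.symm.mul_mul_mul_comm, hf, hpp', mul_zero]
    have hf21 : f * (1 - p) * (f * p) = 0 := by
      rw [hfp'.symm.mul_mul_mul_comm, hf, hp'p, mul_zero]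
    have hca : ∀ {w : ℂ} {x : A}, Commute a x → Commute (a - algebraMap ℂ A w) x :=
      fun hx => hx.sub_left (Algebra.commutes _ _)
    obtain ⟨n, e, hee, heo, hea, hef, hfe, hsum, hel⟩ := ih (f := f * (1 - p)) hf2
      (hfa.mul_right hap') (fun w hw => by
        by_cases hwl : w = l
        · subst hwl
          rw [hfp'.eq, ← mul_assoc]
          exact hpl.mul (IsIdempotentElem.isDrazin hf)
            ((hca hfa).mul_left hfp'.symm)
        · rw [← mul_assoc]
          exact (hfs w (by simp [hwl, hw])).mul (IsIdempotentElem.isDrazin hp')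
            ((hca hap').mul_left hfp'))
    have h1 : ∀ i, f * p * e i = 0 := fun i => by
      rw [← hfe i, ← mul_assoc, hf12, zero_mul]
    have h2 : ∀ i, e i * (f * p) = 0 := fun i => by
      rw [← hef i, mul_assoc, hf21, mul_zero]
    refine ⟨n + 1, Fin.cons (f * p) e, ?_, ?_, ?_, ?_, ?_, ?_, ?_⟩
    · exact fun i => Fin.cases hf1 hee i
    · intro i j
      refine Fin.cases ?_ (fun i => ?_) i <;> refine Fin.cases ?_ (fun j => ?_) j
      · exact fun h => absurd rfl h
      · exact fun _ => h1 j
      · exact fun _ => h2 i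
      · exact fun h => heo i j fun hij => h (by rw [hij])
    · exact fun i => Fin.cases (hfa.mul_right hap) hea i
    · refine fun i => Fin.cases ?_ (fun i => ?_) i
      · change f * p * f = f * p
        rw [mul_assoc, ← hfp.eq, ← mul_assoc, hf]
      · change e i * f = e i
        rw [← hef i, mul_assoc, mul_assoc, ← hfp'.eq, ← mul_assoc f f, hf]
    · refine fun i => Fin.cases ?_ (fun i => ?_) i
      · change f * (f * p) = f * p
        rw [← mul_assoc, hf]
      · change f * e i = e i
        rw [← hfe i, ← mul_assoc, ← mul_assoc, hf]
    · rw [Fin.sum_univ_succ]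
      simp only [Fin.cons_zero, Fin.cons_succ]
      rw [hsum, ← mul_add, add_sub_cancel, mul_one]
    · refine fun i => Fin.cases ?_ hel i
      refine ⟨l, fun w hw => ?_⟩
      change IsDrazin ((a - algebraMap ℂ A w) * (f * p))
      rw [hfp.eq, ← mul_assoc]
      exact (hpw w hw).mul (IsIdempotentElem.isDrazin hf) ((hca hfa).mul_left hfp.symm)

end Splitting

/-! ### Condition 4: decompositions into invariant subspaces. -/

section Operators

variable {X : Type*} [NormedAddCommGroup X] [NormedSpace ℂ X]

theorem pow_apply_coe {t : X →L[ℂ] X} {M : Submodule ℂ X} {u : M →L[ℂ] M}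
    (hu : ∀ x, (u x : X) = t x) (k : ℕ) (x : M) : ((u ^ k) x : X) = (t ^ k) x := by
  induction k generalizing x with
  | zero => simp
  | succ k ih =>
    rw [pow_succ, pow_succ]
    change ((u ^ k) (u x) : X) = (t ^ k) (t x)
    rw [ih, hu]

theorem IsDrazin.restrict_range {t e : X →L[ℂ] X} (he : e * e = e) (hte : Commute t e)
    (h : IsDrazin (t * e)) {u : e.range →L[ℂ] e.range} (hu : ∀ x, (u x : X) = t x) :
    IsDrazin u := by
  obtain ⟨p, d, hp, hc⟩ := h.exists_pow_eq
  have htd : Commute t d := hc t ((Commute.refl t).mul_right hte)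
  have hed : Commute e d := hc e (hte.symm.mul_right (Commute.refl e))
  have hfix : ∀ x : e.range, e x = x := by
    rintro ⟨_, ⟨y, rfl⟩⟩
    exact congrArg (fun f : X →L[ℂ] X => f y) he
  have hd : ∀ x ∈ e.range, d x ∈ e.range := by
    rintro _ ⟨y, rfl⟩
    exact ⟨d y, congrArg (fun f : X →L[ℂ] X => f y) hed.eq⟩
  have hpow := pow_add_eq_of_pow_eq hp 1
  rw [add_comm 1 p, hte.mul_pow, hte.mul_pow, IsIdempotentElem.pow_succ_eq _ he,
    IsIdempotentElem.pow_succ_eq _ he] at hpow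
  refine ⟨p + 1, d.restrict hd, ?_, ?_⟩
  · ext x
    change (u (d.restrict hd x) : X) = d (u x)
    rw [hu, hu]
    exact congrArg (fun f : X →L[ℂ] X => f x) htd.eq
  · ext x
    change ((u ^ (p + 1)) x : X) = ((u ^ (p + 1 + 1)) (d.restrict hd x) : X)
    rw [pow_apply_coe hu, pow_apply_coe hu]
    have h1 := congrArg (fun f : X →L[ℂ] X => f x) hpow
    change (t ^ (p + 1)) (e x) = (t ^ (p + 1 + 1)) (e (d x)) at h1
    have h2 : e (d x) = d x := hfix ⟨d x, hd x x.2⟩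
    rw [h2, hfix] at h1
    exact h1

variable [CompleteSpace X]

theorem exists_decomposition {T : X →L[ℂ] X} (h : (drazinSpectrum T).Finite) :
    ∃ (n : ℕ) (M : Fin n → Submodule ℂ X) (hT : ∀ i, ∀ x ∈ M i, T x ∈ M i),
      (∀ i, IsClosed (M i : Set X)) ∧ DirectSum.IsInternal M ∧
      ∀ i, IsTranslateOfMeromorphic (T.restrict (hT i)) := by
  obtain ⟨n, e, hee, heo, hea, -, -, hsum, hel⟩ := exists_orthogonal_idempotents h h.toFinset
    (f := 1) (mul_one 1) (Commute.one_right T) (fun w hw => by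
      rw [mul_one]
      by_contra hD
      exact hw (h.mem_toFinset.mpr hD))
  have hfix : ∀ i, ∀ x, x ∈ (e i).range ↔ e i x = x := by
    refine fun i x => ⟨?_, fun hx => ⟨x, hx⟩⟩
    rintro ⟨y, rfl⟩
    exact congrArg (fun f : X →L[ℂ] X => f y) (hee i)
  have hT : ∀ i, ∀ x ∈ (e i).range, T x ∈ (e i).range := by
    rintro i _ ⟨y, rfl⟩
    exact ⟨T y, congrArg (fun f : X →L[ℂ] X => f y) (hea i).eq.symm⟩
  have hcl : ∀ i, IsClosed ((e i).range : Set X) := by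
    intro i
    have : ((e i).range : Set X) = {x | e i x = x} := by ext x; exact hfix i x
    rw [this]
    exact isClosed_eq (e i).continuous continuous_id
  refine ⟨n, fun i => (e i).range, hT, hcl, ?_, fun i => ?_⟩
  · refine DirectSum.isInternal_submodule_of_iSupIndep_of_iSup_eq_top ?_ ?_
    · rw [iSupIndep_def]
      intro i
      rw [Submodule.disjoint_def]
      intro x hx hx'
      have hle : (⨆ (j) (_ : j ≠ i), (e j).range) ≤ (e i).ker := by
        refine iSup₂_le fun j hj => ?_
        rintro _ ⟨y, rfl⟩
        exact congrArg (fun f : X →L[ℂ] X => f y) (heo i j hj.symm)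
      have h0 : e i x = 0 := hle hx'
      rw [← (hfix i x).mp hx, h0]
    · rw [eq_top_iff]
      intro x _
      have hx : x = ∑ i, e i x := by
        have := congrArg (fun f : X →L[ℂ] X => f x) hsum
        simpa using this.symm
      rw [hx]
      exact Submodule.sum_mem _ fun i _ => Submodule.mem_iSup_of_mem i ⟨x, rfl⟩
  · obtain ⟨l, hl⟩ := hel i
    have : CompleteSpace (e i).range := (hcl i).completeSpace_coe
    refine ⟨l, isMeromorphic_iff.mpr fun w hw => ?_⟩
    refine IsDrazin.restrict_range (t := T - algebraMap ℂ (X →L[ℂ] X) (l + w)) (hee i)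
      ((hea i).sub_left (Algebra.commutes _ _)) (hl (l + w) (by simpa using hw)) fun x => ?_
    simp [Algebra.algebraMap_eq_smul_one, add_smul, sub_sub]

/-- The topological direct sum decomposition given by an algebraic one into closed subspaces. -/
theorem exists_continuousLinearEquiv {n : ℕ} {M : Fin n → Submodule ℂ X}
    (hcl : ∀ i, IsClosed (M i : Set X)) (hM : DirectSum.IsInternal M) :
    ∃ φ : (∀ i, M i) ≃L[ℂ] X, ∀ m, φ m = ∑ i, (m i : X) := by
  have hcomp : ∀ i, CompleteSpace (M i) := fun i => (hcl i).completeSpace_coe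
  let L : (∀ i, M i) →L[ℂ] X := ∑ i, (M i).subtypeL ∘L ContinuousLinearMap.proj i
  have hL : ∀ m, L m = ∑ i, (m i : X) := fun m => by simp [L]
  have hLeq : (L : (∀ i, M i) →ₗ[ℂ] X) = DirectSum.coeLinearMap M ∘ₗ
      (DirectSum.linearEquivFunOnFintype ℂ (Fin n) fun i => M i).symm.toLinearMap := by
    refine LinearMap.pi_ext fun i x => ?_
    change L (Pi.single i x) = _
    rw [hL, LinearMap.comp_apply, LinearEquiv.coe_coe,
      DirectSum.linearEquivFunOnFintype_symm_single,
      DirectSum.coeLinearMap_lof, Finset.sum_eq_single i]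
    · simp
    · intro j _ hj
      simp [Pi.single_eq_of_ne hj]
    · simp
  have hbij : Function.Bijective L := by
    have h1 : Function.Bijective (DirectSum.coeLinearMap M ∘ₗ
      (DirectSum.linearEquivFunOnFintype ℂ (Fin n) fun i => M i).symm.toLinearMap) :=
      (show Function.Bijective (DirectSum.coeLinearMap M) from hM).comp
        (DirectSum.linearEquivFunOnFintype ℂ (Fin n) fun i => M i).symm.bijective
    rw [← hLeq] at h1
    exact h1
  exact ⟨ContinuousLinearEquiv.ofBijective L (LinearMap.ker_eq_bot.mpr hbij.1)
    (LinearMap.range_eq_top.mpr hbij.2), hL⟩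

/-- The inverses on the pieces are assembled through the topological isomorphism with the product,
which makes the result bounded. The sum of the `p i` is a common exponent. -/
theorem isDrazin_of_isInternal {t : X →L[ℂ] X} {n : ℕ} {M : Fin n → Submodule ℂ X}
    (hcl : ∀ i, IsClosed (M i : Set X)) (hM : DirectSum.IsInternal M)
    {u : ∀ i, M i →L[ℂ] M i} (hu : ∀ i x, (u i x : X) = t x) (h : ∀ i, IsDrazin (u i)) :
    IsDrazin t := by
  obtain ⟨φ, hφ⟩ := exists_continuousLinearEquiv hcl hM
  choose p x hx hpx using h
  let v : (∀ i, M i) →L[ℂ] (∀ i, M i) := ContinuousLinearMap.piMap x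
  have hpow : ∀ (k : ℕ) (m : ∀ i, M i), (t ^ k) (φ m) = φ (fun i => (u i ^ k) (m i)) := by
    intro k m
    rw [hφ, hφ, map_sum]
    exact Finset.sum_congr rfl fun i _ => (pow_apply_coe (hu i) k (m i)).symm
  let N := ∑ i, p i
  have hN : ∀ i, u i ^ N = u i ^ (N + 1) * x i := by
    intro i
    have h1 := pow_add_eq_of_pow_eq (hpx i) (N - p i)
    rwa [Nat.sub_add_cancel (Finset.single_le_sum (fun _ _ => Nat.zero_le _)
      (Finset.mem_univ i))] at h1
  refine ⟨N, φ.toContinuousLinearMap ∘L v ∘L φ.symm.toContinuousLinearMap, ?_, ?_⟩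
  · ext z
    obtain ⟨m, rfl⟩ := φ.surjective z
    change t (φ (v (φ.symm (φ m)))) = φ (v (φ.symm (t (φ m))))
    have h1 := hpow 1
    simp only [pow_one] at h1
    rw [h1, h1, φ.symm_apply_apply, φ.symm_apply_apply]
    congr 1
    ext i
    exact congrArg (fun f : M i →L[ℂ] M i => (f (m i) : X)) (hx i).eq
  · ext z
    obtain ⟨m, rfl⟩ := φ.surjective z
    change (t ^ N) (φ m) = (t ^ (N + 1)) (φ (v (φ.symm (φ m))))
    rw [hpow, hpow, φ.symm_apply_apply]
    congr 1
    ext i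
    exact congrArg (fun f : M i →L[ℂ] M i => (f (m i) : X)) (hN i)

theorem finite_drazinSpectrum_of_decomposition {T : X →L[ℂ] X} {n : ℕ}
    {M : Fin n → Submodule ℂ X} (hT : ∀ i, ∀ x ∈ M i, T x ∈ M i)
    (hcl : ∀ i, IsClosed (M i : Set X)) (hM : DirectSum.IsInternal M)
    (h : ∀ i, IsTranslateOfMeromorphic (T.restrict (hT i))) : (drazinSpectrum T).Finite := by
  have hcomp : ∀ i, CompleteSpace (M i) := fun i => (hcl i).completeSpace_coe
  choose l hl using h
  -- A point different from every centre `l i` is a nonzero shift of each meromorphic piece, hence a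
  -- Drazin point on each of them.
  refine (Set.finite_range l).subset fun w hw => ?_
  by_contra hwl
  refine hw (isDrazin_of_isInternal hcl hM (u := fun i => T.restrict (hT i) -
    l i • ContinuousLinearMap.id ℂ (M i) - algebraMap ℂ (M i →L[ℂ] M i) (w - l i)) ?_ fun i => ?_)
  · intro i x
    simp [Algebra.algebraMap_eq_smul_one, sub_smul]
  · refine isMeromorphic_iff.mp (hl i) _ (sub_ne_zero.mpr fun he => hwl ⟨i, he.symm⟩)

end Operators

end

end MeromorphicOperator

theorem mainTheorem6 {X : Type*} [NormedAddCommGroup X] [NormedSpace ℂ X] [CompleteSpace X]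
    (T F : X →L[ℂ] X) (hTF : Commute T F)
    (hF : ∃ n : ℕ, 1 ≤ n ∧ FiniteDimensional ℂ (F ^ n).range) :
    List.TFAE [
      ∃ P : Polynomial ℂ, 1 ≤ P.natDegree ∧ IsMeromorphic (Polynomial.aeval (T + F) P),
      ∃ (U : Set ℂ) (f : ℂ → ℂ), IsOpen U ∧ spectrum ℂ T ∪ spectrum ℂ (T + F) ⊆ U ∧
        AnalyticOnNhd ℂ f U ∧
        (∀ z ∈ spectrum ℂ T, ¬ ∃ c : ℂ, ∀ w ∈ connectedComponentIn U z, f w = c) ∧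
        ∃ A : X →L[ℂ] X, IsFunctionOf (T + F) U f A ∧ IsMeromorphic A,
      (bFredholmSpectrum T).Finite,
      ∃ (n : ℕ) (M : Fin n → Submodule ℂ X) (hT : ∀ i, ∀ x ∈ M i, T x ∈ M i),
        (∀ i, IsClosed (M i : Set X)) ∧ DirectSum.IsInternal M ∧
        ∀ i, IsTranslateOfMeromorphic (T.restrict (hT i))] := by
  obtain ⟨n, -, hF⟩ := hF
  tfae_have 1 → 2 := fun ⟨P, hP, h⟩ => exists_isFunctionOf_of_polynomial hP h
  tfae_have 2 → 3 := fun ⟨U, f, hU, hσ, hf, hne, A, hA, hmer⟩ =>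
    finite_bFredholmSpectrum_iff.mpr (finite_drazinSpectrum_of_isFunctionOf hTF hF hU
      (Set.subset_union_left.trans hσ) hf hne hA hmer)
  tfae_have 3 → 4 := fun h => exists_decomposition (finite_bFredholmSpectrum_iff.mp h)
  -- The decomposition concerns T and the polynomial T + F, so the Drazin spectrum is transported by
  -- perturbation in between.
  tfae_have 4 → 1 := fun ⟨_, _, hT, hcl, hM, h⟩ =>
    exists_polynomial_isMeromorphic
      ((finite_drazinSpectrum_of_decomposition hT hcl hM h).subset fun _ hz hd =>
        hz (hd.perturb hTF hF))
  tfae_finish
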